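/- Let $n\ge 1$ and consider $\dot x=f(x)+g(x)u$, $y=h(x)+d$ with $f,g:\mathbb R^n\to\mathbb R^n$ and $h:\mathbb R^n\to\mathbb R$ smooth. Assume that $h$ has relative degree $n$ with positive gain, i.e. for all $x\in\mathbb R^n$, $L_gL_f^ih(x)=0$ for $0\le i\le n-2$ and $L_gL_f^{n-1}h(x)>0$, and that $\Psi=(h,L_fh,\dots,L_f^{n-1}h)$ is a diffeomorphism of $\mathbb R^n$ onto $\mathbb R^n$ with $\Psi(0)=0$. Put $z=\Psi(x)$, $\alpha(z)=L_f^nh(x)$, $\beta(z)=L_gL_f^{n-1}h(x)$, $u_0=-\beta(0)^{-1}\alpha(0)$. Controller. For a sampling time $T>0$ the input is constant, equal to $u(k)$, on $[kT,(k+1)T)$; write $z(k)=z(kT)$, $z_{n+1}(k)=\alpha(z(k))+\beta(z(k))u(k)$. Let $v(z)=Kz$, where $K$ is a row vector such that $(A_1+B_1K)^{\mathsf T}P+P(A_1+B_1K)=-Q$ for some symmetric positive definite $P,Q$, with $(A_1,B_1)$ the chain of $n$ integrators. Let $\rho\ge n+1$, let $u(k)=u_k^*$ be fixed constants for $0\le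 k\le\rho-1$ (for instance with $u^*_{\rho-1}=u^*_{\rho-2}$), and for $k\ge\rho-1$ let $$u(k+1)=u(k)+\gamma\big(v(\hat z_1(k),\dots,\hat z_n(k))-\hat z_{n+1}(k)\big),$$ where $\hat z(k)\in\mathbb R^{n+1}$, $k\ge\rho-1$, is produced by a causal estimation technique (from $T$, the outputs $y(t)$, $0\le t\le(k+1)T$, and the inputs $u(0),\dots,u(k)$). Let $e_u(k)=v(z(k))-(\alpha(z(k))+\beta(z(k))u(k))$. Noise. Let $\mathcal D$ be any set of measurable, essentially bounded noise signals $d$, and put $\bar d=\operatorname{ess\,sup}_{t\ge0}|d(t)|$. The estimation technique is assumed to satisfy $e_z=O_{(z,u-u_0)}(T)+O_{\bar d}(T^{-n})$ along the closed loop, that is: for every compact $C\subset\mathbb R^n\times\mathbb R$ there are $M,T_0>0$ such that for all $T\in(0,T_0]$, $d\in\mathcal D$ and $k\ge\rho-1$, and every closed-loop trajectory defined on $[0,(k+1)T]$ along which $(z,u)$ stays in $C$, $$\big\|(z(k),z_{n+1}(k))-\hat z(k)\big\|\le MT\,\|(z(k),u(k)-u_0)\|+M\,\bar d\,T^{-n}.$$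 Claim. For every compact set $\mathcal S\subset\mathbb R^n$ of initial conditions containing the origin in its interior, and every sufficiently small gain $\gamma>0$ (that is, $0<\gamma<\gamma_{\max}$ for some $\gamma_{\max}>0$ that depends on the system, $K$, $\rho$, $u^*$ and $\mathcal S$ only, and with $\gamma_{\max}\ge\bar\beta^{-1}$ for every upper bound $\bar\beta$ of $\beta$ on $\mathbb R^n$), there are $T^*>0$ and constants $b_1,b_2,b_3>0$ such that for every $T\in(0,T^*]$, every $d\in\mathcal D$ with $\bar d\le b_1T^n$ and every $x(0)\in\mathcal S$, the closed loop has a solution on $[0,\infty)$, and every such solution satisfies $\|\hat z(k)\|\le b_2$ for all $k\ge\rho-1$, $|e_u(k)|\le b_2$ for all $k\in\mathbb N$, $\|x(t)\|\le b_2$ for all $t\ge0$, and $$\limsup_{t\to\infty}\|x(t)\|\le b_3\,\bar d\,T^{-n}.$$ -/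

import Mathlib

open scoped ContDiff

noncomputable section

/-- The Lie derivative `L_f h = (∂h/∂x) f` of a function `h` along a vector field `f`. -/
def lieDeriv {n : ℕ} (f : EuclideanSpace ℝ (Fin n) → EuclideanSpace ℝ (Fin n))
    (h : EuclideanSpace ℝ (Fin n) → ℝ) : EuclideanSpace ℝ (Fin n) → ℝ :=
  fun x => fderiv ℝ h x (f x)

/-- The output `h` of `ẋ = f(x) + g(x) u` has relative degree `n` on the whole of `ℝⁿ`, and the
control gain `L_g L_f^{n-1} h`, which never vanishes, has positive sign. -/
def HasPosRelativeDegree {n : ℕ} (f g : EuclideanSpace ℝ (Fin n) → EuclideanSpace ℝ (Fin n))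
    (h : EuclideanSpace ℝ (Fin n) → ℝ) : Prop :=
  (∀ i : ℕ, i + 2 ≤ n → ∀ x, lieDeriv g ((lieDeriv f)^[i] h) x = 0) ∧
    ∀ x, 0 < lieDeriv g ((lieDeriv f)^[n - 1] h) x

/-- The linearizing coordinates `z = Ψ(x) = (h(x), L_f h(x), …, L_f^{n-1} h(x))`. -/
def linCoord {n : ℕ} (f : EuclideanSpace ℝ (Fin n) → EuclideanSpace ℝ (Fin n))
    (h : EuclideanSpace ℝ (Fin n) → ℝ) (x : EuclideanSpace ℝ (Fin n)) :
    EuclideanSpace ℝ (Fin n) :=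
  WithLp.toLp 2 fun i => (lieDeriv f)^[(i : ℕ)] h x

/-- `Ψ : ℝⁿ → ℝⁿ` is a (global, smooth) diffeomorphism. -/
def IsGlobalDiffeo {n : ℕ} (Ψ : EuclideanSpace ℝ (Fin n) → EuclideanSpace ℝ (Fin n)) : Prop :=
  ContDiff ℝ ∞ Ψ ∧ ∃ Φ : EuclideanSpace ℝ (Fin n) → EuclideanSpace ℝ (Fin n),
    ContDiff ℝ ∞ Φ ∧ Function.LeftInverse Φ Ψ ∧ Function.RightInverse Φ Ψ

/-- The function `α`, expressed in the original state: `α(Ψ(x)) = L_f^n h(x)`. -/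
def alphaFn {n : ℕ} (f : EuclideanSpace ℝ (Fin n) → EuclideanSpace ℝ (Fin n))
    (h : EuclideanSpace ℝ (Fin n) → ℝ) (x : EuclideanSpace ℝ (Fin n)) : ℝ :=
  (lieDeriv f)^[n] h x

/-- The function `β`, expressed in the original state: `β(Ψ(x)) = L_g L_f^{n-1} h(x)`. -/
def betaFn {n : ℕ} (f g : EuclideanSpace ℝ (Fin n) → EuclideanSpace ℝ (Fin n))
    (h : EuclideanSpace ℝ (Fin n) → ℝ) (x : EuclideanSpace ℝ (Fin n)) : ℝ :=
  lieDeriv g ((lieDeriv f)^[n - 1] h) x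

/-- The equilibrium input `u₀ = -β(0)⁻¹ α(0)` (used when `Ψ(0) = 0`). -/
def eqInput {n : ℕ} (f g : EuclideanSpace ℝ (Fin n) → EuclideanSpace ℝ (Fin n))
    (h : EuclideanSpace ℝ (Fin n) → ℝ) : ℝ :=
  -((betaFn f g h 0)⁻¹ * alphaFn f h 0)

/-- The vector `(z₁, …, z_n, z_{n+1})` with `z = Ψ(x)` and `z_{n+1} = α(z) + β(z) u`: the quantity
to be estimated when the state is `x` and the input is `u`. -/
def extState {n : ℕ} (f g : EuclideanSpace ℝ (Fin n) → EuclideanSpace ℝ (Fin n))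
    (h : EuclideanSpace ℝ (Fin n) → ℝ) (x : EuclideanSpace ℝ (Fin n)) (u : ℝ) :
    EuclideanSpace ℝ (Fin (n + 1)) :=
  WithLp.toLp 2 (Fin.snoc (α := fun _ => ℝ) (fun i : Fin n => linCoord f h x i)
    (alphaFn f h x + betaFn f g h x * u))

/-- The linear virtual input `v(z) = K z`. -/
def virtualInput {n : ℕ} (K : Fin n → ℝ) (z : Fin n → ℝ) : ℝ := ∑ i, K i * z i

/-- The input error `e_u = v(z) - (α(z) + β(z) u)` at state `x` and input `u`. -/
def inputError {n : ℕ} (f g : EuclideanSpace ℝ (Fin n) → EuclideanSpace ℝ (Fin n))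
    (h : EuclideanSpace ℝ (Fin n) → ℝ) (K : Fin n → ℝ) (x : EuclideanSpace ℝ (Fin n))
    (u : ℝ) : ℝ :=
  virtualInput K (fun i => linCoord f h x i) - (alphaFn f h x + betaFn f g h x * u)

/-- The matrix `A₁` of the chain of `n` integrators. -/
def chainA (n : ℕ) : Matrix (Fin n) (Fin n) ℝ :=
  Matrix.of fun i j => if (j : ℕ) = (i : ℕ) + 1 then 1 else 0

/-- The input vector `B₁` of the chain of `n` integrators. -/
def chainB (n : ℕ) : Fin n → ℝ := fun i => if (i : ℕ) + 1 = n then 1 else 0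

/-- `K` is a suitable gain: for some symmetric positive definite `P` and `Q`,
`(A₁ + B₁ K)ᵀ P + P (A₁ + B₁ K) = -Q`. -/
def IsStabilizingGain {n : ℕ} (K : Fin n → ℝ) : Prop :=
  ∃ P Q : Matrix (Fin n) (Fin n) ℝ, P.PosDef ∧ Q.PosDef ∧
    (chainA n + Matrix.vecMulVec (chainB n) K).transpose * P +
      P * (chainA n + Matrix.vecMulVec (chainB n) K) = -Q

/-- The noise `d` is measurable and essentially bounded on `[0, ∞)`. -/
def EssBounded (d : ℝ → ℝ) : Prop :=
  MeasureTheory.MemLp d ⊤ (MeasureTheory.volume.restrict (Set.Ici (0 : ℝ)))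

/-- The noise level `ess sup_{t ≥ 0} |d(t)|` of an essentially bounded noise. -/
def noiseLevel (d : ℝ → ℝ) : ℝ :=
  (MeasureTheory.eLpNorm d ⊤ (MeasureTheory.volume.restrict (Set.Ici (0 : ℝ)))).toReal

/-- An estimation technique: from the sampling time `T`, the measured output signal `y` and the
input sequence `u`, it produces the estimates `ẑ(k) ∈ ℝ^{n+1}`. -/
abbrev Estimator (n : ℕ) : Type :=
  ℝ → (ℝ → ℝ) → (ℕ → ℝ) → ℕ → EuclideanSpace ℝ (Fin (n + 1))

/-- The estimate `ẑ(k)`, which is used for the input `u(k+1)` applied from time `(k+1)T` on, only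
depends on what has been measured until that time and on the inputs applied until that time. -/
def Estimator.IsCausal {n : ℕ} (est : Estimator n) : Prop :=
  ∀ (T : ℝ) (y y' : ℝ → ℝ) (u u' : ℕ → ℝ) (k : ℕ), 0 < T →
    (∀ t ∈ Set.Icc (0 : ℝ) (((k : ℝ) + 1) * T), y t = y' t) →
    (∀ j ≤ k, u j = u' j) → est T y u k = est T y' u' k

/-- `x` solves `ẋ = f(x) + g(x) u` on the first `N` sampling intervals, that is on `[0, N T]`, with
the piecewise constant input equal to `u j` on `[j T, (j+1) T)`. -/
def IsSampledSolution {n : ℕ} (f g : EuclideanSpace ℝ (Fin n) → EuclideanSpace ℝ (Fin n))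
    (T : ℝ) (N : ℕ) (u : ℕ → ℝ) (x : ℝ → EuclideanSpace ℝ (Fin n)) : Prop :=
  ContinuousOn x (Set.Icc 0 ((N : ℝ) * T)) ∧
    ∀ j < N, ∀ t ∈ Set.Ico ((j : ℝ) * T) (((j : ℝ) + 1) * T),
      HasDerivWithinAt x (f (x t) + u j • g (x t)) (Set.Ici t) t

/-- The closed loop on the first `N` sampling intervals, for the sampling time `T`, the measurement
noise `d` and the initial state `x₀`: fixed inputs `ustar k` for `k < ρ`, and
`u(k+1) = u(k) + γ (v(ẑ(k)) - ẑ_{n+1}(k))` once the first estimate `ẑ(ρ-1)` is available, where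
`ẑ` is computed from the noisy output `y = h(x) + d`. -/
def IsClosedLoop {n : ℕ} (f g : EuclideanSpace ℝ (Fin n) → EuclideanSpace ℝ (Fin n))
    (h : EuclideanSpace ℝ (Fin n) → ℝ) (K : Fin n → ℝ) (γ : ℝ) (ρ : ℕ) (ustar : ℕ → ℝ)
    (est : Estimator n) (T : ℝ) (d : ℝ → ℝ) (x₀ : EuclideanSpace ℝ (Fin n)) (N : ℕ)
    (u : ℕ → ℝ) (x : ℝ → EuclideanSpace ℝ (Fin n)) : Prop :=
  x 0 = x₀ ∧ IsSampledSolution f g T N u x ∧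
    (∀ k < N, k < ρ → u k = ustar k) ∧
    ∀ k : ℕ, k + 1 < N → ρ ≤ k + 1 →
      u (k + 1) = u k + γ * (virtualInput K
          (fun i => est T (fun t => h (x t) + d t) u k (Fin.castSucc i)) -
        est T (fun t => h (x t) + d t) u k (Fin.last n))

/-- The closed loop on `[0, ∞)`. -/
def IsGlobalClosedLoop {n : ℕ} (f g : EuclideanSpace ℝ (Fin n) → EuclideanSpace ℝ (Fin n))
    (h : EuclideanSpace ℝ (Fin n) → ℝ) (K : Fin n → ℝ) (γ : ℝ) (ρ : ℕ) (ustar : ℕ → ℝ)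
    (est : Estimator n) (T : ℝ) (d : ℝ → ℝ) (x₀ : EuclideanSpace ℝ (Fin n))
    (u : ℕ → ℝ) (x : ℝ → EuclideanSpace ℝ (Fin n)) : Prop :=
  ∀ N : ℕ, IsClosedLoop f g h K γ ρ ustar est T d x₀ N u x

/-- The estimation error satisfies `e_z = O_{(z, u - u₀)}(T) + O_{d̄}(T^{-n})` along the closed loop,
for noise signals in `D`: for every compact set `C` there are constants `M` and `T₀` such that,
for all `T ∈ (0, T₀]`, the bound `‖e_z(k)‖ ≤ M T ‖(z(k), u(k) - u₀)‖ + M d̄ T^{-n}` holds as long as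
`(z, u)` has not left `C`. -/
def Estimator.HasErrorBound {n : ℕ} (est : Estimator n)
    (f g : EuclideanSpace ℝ (Fin n) → EuclideanSpace ℝ (Fin n))
    (h : EuclideanSpace ℝ (Fin n) → ℝ) (K : Fin n → ℝ) (γ : ℝ) (ρ : ℕ) (ustar : ℕ → ℝ)
    (D : Set (ℝ → ℝ)) : Prop :=
  ∀ C : Set (EuclideanSpace ℝ (Fin n) × ℝ), IsCompact C →
    ∃ M > (0 : ℝ), ∃ T₀ > (0 : ℝ), ∀ T ∈ Set.Ioc 0 T₀, ∀ d ∈ D,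
      ∀ (x₀ : EuclideanSpace ℝ (Fin n)) (k : ℕ) (u : ℕ → ℝ) (x : ℝ → EuclideanSpace ℝ (Fin n)),
        ρ ≤ k + 1 →
        IsClosedLoop f g h K γ ρ ustar est T d x₀ (k + 1) u x →
        (∀ j ≤ k, ∀ t ∈ Set.Icc ((j : ℝ) * T) (((j : ℝ) + 1) * T),
          (linCoord f h (x t), u j) ∈ C) →
        ‖extState f g h (x (k * T)) (u k) - est T (fun t => h (x t) + d t) u k‖ ≤
          M * T * √(‖linCoord f h (x (k * T))‖ ^ 2 + (u k - eqInput f g h) ^ 2) +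
            M * noiseLevel d / T ^ n

end

/-! In the coordinates `z = Ψ(x)` the plant is a chain of integrators, and adding and subtracting `K
z` in its last equation gives `ż = (A₁ + B₁K) z - e B₁`, where `e = e_u = G z - β(z) u` with `G z =
K z - α(z)`. The controller integrates an estimate of `e`. With `z'` the next sampled state and `ε`
the effect of the estimation error, the next input error is `(1 - γ β(z')) e - γ β(z') ε` plus the
variation of `e` caused by the motion of `z` with `u` frozen, which is `O(T)`. As long as `z` stays
in a ball where `m ≤ β` and `γ β ≤ 1`, the error `e` contracts by a factor bounded away from `1` at
each sample, while the Lyapunov norm `‖Λ z‖` contracts only by `1 - O(T)`.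

These are a fast and a slow mode. With `δ = d̄ T⁻ⁿ`, the composite function `W = ‖Λ z‖ + μ T |e|`
satisfies `W' ≤ (1 - ν T) W + c T δ` for small `T`: the weight `μ T` lets the contraction of `e` pay
for its effect on `z`, and the `O(T)` part of the estimation error is absorbed by the two decay
rates. Hence `W` decays geometrically to a level `O(δ)`, which gives the limsup. One sample is
treated in `exists_sampling_step_bound`, `slow_fast_comparison` and `exists_closedLoop_step_bound`.

These estimates hold only in a ball, so `exists_closedLoop_invariance` proves by induction on the
sample that the ball is never left; the start-up phase lasts a time `ρ T`, during which `z` hardly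
moves. The order of the choices avoids circularity: the radius `R` precedes `γ`, and the input bound
`U` precedes the estimation constant `M`, which depends on the compact set defined by `R` and `U`.
The same finite-horizon bounds make every partial solution continuable, which gives global existence
through `exists_isGlobalClosedLoop`. -/

/-- `z` solves the autonomous equation `ż = F z` on `[s, s + T]`, with right derivatives. -/
def SolvesOn {E : Type*} [NormedAddCommGroup E] [NormedSpace ℝ E] (F : E → E) (z : ℝ → E)
    (s T : ℝ) : Prop :=
  ContinuousOn z (Set.Icc s (s + T)) ∧
    ∀ t ∈ Set.Ico s (s + T), HasDerivWithinAt z (F (z t)) (Set.Ici t) t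

/-! ### One sampling interval with constant input -/

section ODE

variable {E E' : Type*} [NormedAddCommGroup E] [NormedSpace ℝ E]
  [NormedAddCommGroup E'] [NormedSpace ℝ E']

/-- A solution cannot leave a unit ball faster than the speed of the vector field allows. -/
theorem SolvesOn.norm_sub_le_of_speed_lt {F : E → E} {z : ℝ → E} {s T L : ℝ}
    (hz : SolvesOn F z s T) (hL : 0 ≤ L) (hF : ∀ w, ‖w - z s‖ ≤ 1 → ‖F w‖ < L)
    (hLT : L * T ≤ 1) : ∀ t ∈ Set.Icc s (s + T), ‖z t - z s‖ ≤ L * (t - s) := by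
  intro t ht
  refine image_norm_le_of_norm_deriv_right_lt_deriv_boundary (f := fun t => z t - z s)
    (f' := fun t => F (z t)) (B := fun t => L * (t - s)) (B' := fun _ => L)
    (hz.1.sub continuousOn_const) (fun x hx => (hz.2 x hx).sub_const _) (by simp) ?_ ?_ ht
  · intro x
    simpa using ((hasDerivAt_id x).sub_const s).const_mul L
  -- The speed matters only where the barrier `L * (t - s)` is touched; there its height is at most
  -- `L * T ≤ 1`, so the point is still in the unit ball.
  · intro x hx hxe
    refine hF _ (hxe.le.trans (le_trans ?_ hLT))
    exact mul_le_mul_of_nonneg_left (by linarith [hx.2]) hL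

/-- Gronwall's inequality combined with `exp x - 1 ≤ 2 x` on `[0, 1]`. Unlike a plain speed bound,
the estimate is proportional to `r`, hence vanishes with the state and the input error; asymptotic
decay needs this. -/
theorem SolvesOn.norm_sub_le_of_linear_growth {F : E → E} {z : ℝ → E} {s T c r : ℝ}
    (hz : SolvesOn F z s T) (hc : 0 < c) (hr : 0 ≤ r) (hcT : c * T ≤ 1)
    (hF : ∀ t ∈ Set.Icc s (s + T), ‖F (z t)‖ ≤ c * (‖z t - z s‖ + r)) :
    ∀ t ∈ Set.Icc s (s + T), ‖z t - z s‖ ≤ 2 * c * r * (t - s) := by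
  intro t ht
  have h := norm_le_gronwallBound_of_norm_deriv_right_le (f := fun t => z t - z s)
    (f' := fun t => F (z t)) (δ := 0) (K := c) (ε := c * r)
    (hz.1.sub continuousOn_const) (fun x hx => (hz.2 x hx).sub_const _) (by simp)
    (fun x hx => by
      have := hF x (Set.Ico_subset_Icc_self hx)
      linarith) t ht
  rw [gronwallBound_of_K_ne_0 hc.ne'] at h
  have h0 : 0 ≤ c * (t - s) := mul_nonneg hc.le (by linarith [ht.1])
  have h1 : c * (t - s) ≤ 1 :=
    le_trans (mul_le_mul_of_nonneg_left (by linarith [ht.2]) hc.le) hcT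
  have h2 := Real.abs_exp_sub_one_le (x := c * (t - s)) (by rwa [abs_of_nonneg h0])
  have h3 := (le_abs_self _).trans h2
  rw [abs_of_nonneg h0] at h3
  calc ‖z t - z s‖ ≤ c * r / c * (Real.exp (c * (t - s)) - 1) := by simpa using h
    _ = r * (Real.exp (c * (t - s)) - 1) := by field_simp
    _ ≤ r * (2 * (c * (t - s))) := mul_le_mul_of_nonneg_left h3 hr
    _ = _ := by ring

/-- Consistency of the explicit Euler step. -/
theorem SolvesOn.norm_sub_euler_le {F : E → E} {z : ℝ → E} {s T c r : ℝ}
    (hz : SolvesOn F z s T) (hT : 0 ≤ T) (hc : 0 < c) (hr : 0 ≤ r) (hcT : c * T ≤ 1)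
    (hF : ∀ t ∈ Set.Icc s (s + T), ‖F (z t) - F (z s)‖ ≤ c * ‖z t - z s‖)
    (hF0 : ‖F (z s)‖ ≤ c * r) :
    ‖z (s + T) - (z s + T • F (z s))‖ ≤ 2 * c ^ 2 * r * T ^ 2 := by
  have h1 := hz.norm_sub_le_of_linear_growth hc hr hcT (fun t ht => by
    have := norm_add_le (F (z t) - F (z s)) (F (z s))
    rw [sub_add_cancel] at this
    linarith [hF t ht])
  -- After subtracting the Euler line, the derivative is the variation of `F` along the solution,
  -- which is `O(T)`; integrating over the interval gains the second factor `T`.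
  have h2 := norm_image_sub_le_of_norm_deriv_right_le_segment
    (f := fun t => z t - (t - s) • F (z s)) (f' := fun t => F (z t) - F (z s))
    (C := 2 * c ^ 2 * r * T) (a := s) (b := s + T)
    (hz.1.sub (by fun_prop)) (fun x hx => by
      refine (hz.2 x hx).sub ?_
      simpa using (((hasDerivAt_id x).sub_const s).smul_const (F (z s))).hasDerivWithinAt)
    (fun x hx => by
      have hx' := Set.Ico_subset_Icc_self hx
      calc ‖F (z x) - F (z s)‖ ≤ c * ‖z x - z s‖ := hF x hx'
        _ ≤ c * (2 * c * r * (x - s)) := mul_le_mul_of_nonneg_left (h1 x hx') hc.le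
        _ ≤ c * (2 * c * r * T) := by
          have : x - s ≤ T := by linarith [hx.2]
          gcongr
        _ = _ := by ring) (s + T) ⟨by linarith, le_rfl⟩
  calc ‖z (s + T) - (z s + T • F (z s))‖
      = ‖z (s + T) - (s + T - s) • F (z s) - (z s - (s - s) • F (z s))‖ := by
        congr 1
        simp only [add_sub_cancel_left, sub_self, zero_smul, sub_zero]
        abel
    _ ≤ 2 * c ^ 2 * r * T * (s + T - s) := h2
    _ = _ := by ring

/-- One sampling interval of `ż = A z - e(z, u) b`, measured by the Lyapunov norm `‖Λ z‖`. -/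
theorem exists_sampling_step_bound (A : E →L[ℝ] E) (b : E) (Λ : E →L[ℝ] E') (e : E → ℝ → ℝ)
    {R U l a τ p : ℝ} (hp : 0 < p) (hΛ : ∀ z, p * ‖z‖ ≤ ‖Λ z‖) (ha : 0 < a) (hτ : 0 < τ)
    (hLyap : ∀ T ∈ Set.Ioc 0 τ, ∀ z, ‖Λ (z + T • A z)‖ ≤ (1 - a * T) * ‖Λ z‖)
    (hl0 : 0 ≤ l)
    (hl : ∀ u, |u| ≤ U → ∀ z w, ‖z‖ ≤ R → ‖w‖ ≤ R → |e z u - e w u| ≤ l * ‖z - w‖) :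
    ∃ c > 0, ∃ τ' > 0, ∀ T ∈ Set.Ioc 0 τ', ∀ (s u : ℝ) (z : ℝ → E), |u| ≤ U →
      SolvesOn (fun w => A w - e w u • b) z s T → (∀ t ∈ Set.Icc s (s + T), ‖z t‖ ≤ R) →
      (∀ t ∈ Set.Icc s (s + T), ‖z t - z s‖ ≤ c * T * (‖z s‖ + |e (z s) u|)) ∧
        ‖Λ (z (s + T))‖ ≤ (1 - a / 2 * T) * ‖Λ (z s)‖ + c * T * |e (z s) u| := by
  set c₁ : ℝ := ‖A‖ + ‖b‖ * (1 + l) + 1 with hc₁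
  have hbl : 0 ≤ ‖b‖ * l := by positivity
  have hc₁A : ‖A‖ ≤ c₁ := by rw [hc₁]; linarith [norm_nonneg b]
  have hc₁b : ‖b‖ ≤ c₁ := by rw [hc₁]; linarith [norm_nonneg A]
  have hc₁l : ‖A‖ + ‖b‖ * l ≤ c₁ := by rw [hc₁]; linarith [norm_nonneg b]
  have hc₁0 : 0 < c₁ := by positivity
  set D : ℝ := ‖Λ‖ * (2 * c₁ ^ 2) with hD
  have hD0 : 0 ≤ D := by positivity
  -- `2 * c₁` serves the excursion bound, `‖Λ b‖ + D` the Lyapunov bound. The last constraint on `T`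
  -- lets half of the decay `a * T` absorb the part of the Euler error proportional to `‖z s‖`.
  refine ⟨2 * c₁ + ‖Λ b‖ + D, by positivity,
    min (min τ (1 / c₁)) (min 1 (a / 2 * p / (D + 1))), by positivity, ?_⟩
  intro T hT s u z hu hz hzR
  have hT0 : 0 < T := hT.1
  have hTτ : T ≤ τ := hT.2.trans ((min_le_left _ _).trans (min_le_left _ _))
  have hTc : c₁ * T ≤ 1 := by
    have : T ≤ 1 / c₁ := hT.2.trans ((min_le_left _ _).trans (min_le_right _ _))
    rw [le_div_iff₀ hc₁0] at this
    linarith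
  have hT1 : T ≤ 1 := hT.2.trans ((min_le_right _ _).trans (min_le_left _ _))
  have hTD : D * T ≤ a / 2 * p := by
    have : T ≤ a / 2 * p / (D + 1) := hT.2.trans ((min_le_right _ _).trans (min_le_right _ _))
    rw [le_div_iff₀ (by positivity)] at this
    linarith
  set r : ℝ := ‖z s‖ + |e (z s) u| with hr
  have hr0 : 0 ≤ r := by positivity
  have hs : s ∈ Set.Icc s (s + T) := ⟨le_rfl, by linarith⟩
  have hF0 : ‖A (z s) - e (z s) u • b‖ ≤ c₁ * r := by
    calc ‖A (z s) - e (z s) u • b‖ ≤ ‖A‖ * ‖z s‖ + |e (z s) u| * ‖b‖ := by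
          refine (norm_sub_le _ _).trans (add_le_add (A.le_opNorm _) ?_)
          rw [norm_smul, Real.norm_eq_abs]
      _ ≤ c₁ * ‖z s‖ + |e (z s) u| * c₁ := by gcongr
      _ = _ := by rw [hr]; ring
  have hFl : ∀ t ∈ Set.Icc s (s + T),
      ‖(A (z t) - e (z t) u • b) - (A (z s) - e (z s) u • b)‖ ≤ c₁ * ‖z t - z s‖ := by
    intro t ht
    have he := hl u hu (z t) (z s) (hzR t ht) (hzR s hs)
    calc ‖(A (z t) - e (z t) u • b) - (A (z s) - e (z s) u • b)‖
        = ‖A (z t - z s) - (e (z t) u - e (z s) u) • b‖ := by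
          rw [map_sub, sub_smul]; congr 1; abel
      _ ≤ ‖A‖ * ‖z t - z s‖ + |e (z t) u - e (z s) u| * ‖b‖ := by
          refine (norm_sub_le _ _).trans (add_le_add (A.le_opNorm _) ?_)
          rw [norm_smul, Real.norm_eq_abs]
      _ ≤ ‖A‖ * ‖z t - z s‖ + (l * ‖z t - z s‖) * ‖b‖ := by gcongr
      _ = (‖A‖ + ‖b‖ * l) * ‖z t - z s‖ := by ring
      _ ≤ _ := by gcongr
  have hΛn := norm_nonneg (Λ b)
  constructor
  · intro t ht
    have h1 := hz.norm_sub_le_of_linear_growth hc₁0 hr0 hTc (fun t ht => by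
      have := norm_add_le ((A (z t) - e (z t) u • b) - (A (z s) - e (z s) u • b))
        (A (z s) - e (z s) u • b)
      rw [sub_add_cancel] at this
      linarith [hFl t ht]) t ht
    refine h1.trans ?_
    have : t - s ≤ T := by linarith [ht.2]
    calc 2 * c₁ * r * (t - s) ≤ 2 * c₁ * r * T := by gcongr
      _ = 2 * c₁ * T * r := by ring
      _ ≤ _ := by gcongr; linarith
  · have h1 := hz.norm_sub_euler_le hT0.le hc₁0 hr0 hTc hFl hF0
    have h2 := hLyap T ⟨hT0, hTτ⟩ (z s)
    -- Contracted Euler step of the nominal system, effect of the input error, and consistency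
    -- error.
    have h3 : Λ (z (s + T)) = Λ (z s + T • A (z s)) - (T * e (z s) u) • Λ b +
        Λ (z (s + T) - (z s + T • (A (z s) - e (z s) u • b))) := by
      simp only [map_sub, map_add, map_smul, smul_sub, smul_smul]
      abel
    have h4 : ‖Λ (z (s + T) - (z s + T • (A (z s) - e (z s) u • b)))‖ ≤ D * r * T ^ 2 := by
      refine (Λ.le_opNorm _).trans ((mul_le_mul_of_nonneg_left h1 (norm_nonneg _)).trans ?_)
      rw [hD]
      exact le_of_eq (by ring)
    have h5 : ‖(T * e (z s) u) • Λ b‖ = T * |e (z s) u| * ‖Λ b‖ := by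
      rw [norm_smul, Real.norm_eq_abs, abs_mul, abs_of_pos hT0]
    have h6 : ‖Λ (z (s + T))‖ ≤ ‖Λ (z s + T • A (z s))‖ + ‖(T * e (z s) u) • Λ b‖ +
        ‖Λ (z (s + T) - (z s + T • (A (z s) - e (z s) u • b)))‖ := by
      conv_lhs => rw [h3]
      exact (norm_add_le _ _).trans (add_le_add (norm_sub_le _ _) le_rfl)
    have h7 : D * ‖z s‖ * T ^ 2 ≤ a / 2 * T * ‖Λ (z s)‖ := by
      calc D * ‖z s‖ * T ^ 2 = (D * T) * ‖z s‖ * T := by ring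
        _ ≤ (a / 2 * p) * ‖z s‖ * T := by gcongr
        _ = a / 2 * T * (p * ‖z s‖) := by ring
        _ ≤ _ := by gcongr; exact hΛ _
    have h8 : D * |e (z s) u| * T ^ 2 ≤ D * T * |e (z s) u| := by
      have : T ^ 2 ≤ T := by nlinarith
      calc D * |e (z s) u| * T ^ 2 ≤ D * |e (z s) u| * T := by gcongr
        _ = _ := by ring
    have h9 : 0 ≤ c₁ * T * |e (z s) u| := by positivity
    rw [h5] at h6
    rw [hr] at h4
    linarith

end ODE

/-! ### Coupling of the slow and fast modes -/

/-- Composite Lyapunov function of a slow mode `N` and a fast mode `E` of a sampled system. -/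
theorem slow_fast_comparison {a c q T N E N' E' δ : ℝ} (hc : 0 < c) (hq : 0 < q)
    (hT : 0 < T) (hN : 0 ≤ N) (hE : 0 ≤ E) (hTa : 4 * c / q * c * T ≤ a) (hTq : a * T ≤ q / 4)
    (hN' : N' ≤ (1 - 2 * a * T) * N + c * T * E)
    (hE' : E' ≤ (1 - q / 2) * E + c * T * N + c * δ) :
    N' + 4 * c / q * T * E' ≤ (1 - a * T) * (N + 4 * c / q * T * E) + 4 * c / q * c * T * δ := by
  -- This weight turns the coupling `c * T * E` into a quarter `q / 4` of the weighted fast mode;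
  -- another quarter pays for the decay `a * T` demanded of it, which uses up the contraction `q /
  -- 2`.
  set μ := 4 * c / q with hμ
  have hμ0 : 0 < μ := by positivity
  have hμq : c = μ * (q / 4) := by rw [hμ]; field_simp
  have h1 : μ * T * E' ≤ μ * T * ((1 - q / 2) * E + c * T * N + c * δ) := by gcongr
  have h2 : (μ * c * T) * (T * N) ≤ a * (T * N) := by gcongr
  have h3 : (a * T) * (μ * T * E) ≤ q / 4 * (μ * T * E) := by gcongr
  have h4 : c * T * E = q / 4 * (μ * T * E) := by
    conv_lhs => rw [hμq]
    ring
  nlinarith [h1, h2, h3, h4, hN']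

/-! ### Closed loop in linearizing coordinates -/

section ClosedLoop

variable {E E' : Type*} [NormedAddCommGroup E] [NormedSpace ℝ E]
  [NormedAddCommGroup E'] [NormedSpace ℝ E']

set_option maxHeartbeats 400000 in
/-- One sampling interval of the closed loop, with `e(z, u) = G z - β z * u` and the update
`u' = u + γ (e + ε)`, where the estimation error `ε` is small relative to the state. -/
theorem exists_closedLoop_step_bound (A : E →L[ℝ] E) (b : E) (Λ : E →L[ℝ] E') (G β : E → ℝ)
    {R U l l₀ m γ u₀ M a τ p : ℝ} (hp : 0 < p) (hΛ : ∀ z, p * ‖z‖ ≤ ‖Λ z‖) (ha : 0 < a)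
    (hτ : 0 < τ) (hLyap : ∀ T ∈ Set.Ioc 0 τ, ∀ z, ‖Λ (z + T • A z)‖ ≤ (1 - a * T) * ‖Λ z‖)
    (hl0 : 0 ≤ l) (hl : ∀ u, |u| ≤ U → ∀ z w, ‖z‖ ≤ R → ‖w‖ ≤ R →
      |(G z - β z * u) - (G w - β w * u)| ≤ l * ‖z - w‖)
    (hγ : 0 < γ) (hm : 0 < m) (hβ : ∀ z, ‖z‖ ≤ R → m ≤ β z) (hγβ : ∀ z, ‖z‖ ≤ R → γ * β z ≤ 1)
    (hl₀0 : 0 ≤ l₀) (hu₀ : ∀ z u, ‖z‖ ≤ R → m * |u - u₀| ≤ l₀ * ‖z‖ + |G z - β z * u|)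
    (hM : 0 < M) :
    ∃ c > 0, ∃ ν > 0, ∃ μ > 0, ∃ q > 0, q ≤ 1 ∧ ∃ τ' > 0, ν * τ' ≤ 1 ∧ ∀ T ∈ Set.Ioc 0 τ',
      ∀ (δ s u u' ε : ℝ) (z : ℝ → E), 0 ≤ δ → |u| ≤ U →
      SolvesOn (fun w => A w - (G w - β w * u) • b) z s T →
      (∀ t ∈ Set.Icc s (s + T), ‖z t‖ ≤ R) →
      u' = u + γ * ((G (z s) - β (z s) * u) + ε) →
      |ε| ≤ M * T * (‖z s‖ + |u - u₀|) + M * δ →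
      ‖Λ (z (s + T))‖ + μ * T * |G (z (s + T)) - β (z (s + T)) * u'| ≤
          (1 - ν * T) * (‖Λ (z s)‖ + μ * T * |G (z s) - β (z s) * u|) + c * T * δ ∧
        |G (z (s + T)) - β (z (s + T)) * u'| ≤
          (1 - q) * |G (z s) - β (z s) * u| + c * T * ‖Λ (z s)‖ + c * δ ∧
        ∀ t ∈ Set.Icc s (s + T),
          ‖z t‖ ≤ c * (‖Λ (z s)‖ + μ * T * |G (z s) - β (z s) * u|) := by
  obtain ⟨c₁, hc₁, τ₁, hτ₁, hstep⟩ := exists_sampling_step_bound A b Λ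
    (fun z u => G z - β z * u) hp hΛ ha hτ hLyap hl0 hl
  by_cases hR : 0 ≤ R
  swap
  · refine ⟨1, one_pos, 1, one_pos, 1, one_pos, 1, one_pos, le_rfl, 1, one_pos, by norm_num, ?_⟩
    intro T hT δ s u u' ε z _ _ _ hzR
    exact absurd ((norm_nonneg _).trans (hzR s ⟨le_rfl, by linarith [hT.1]⟩)) hR
  have h0R : ‖(0 : E)‖ ≤ R := by simpa using hR
  set q := γ * m with hq
  have hq0 : 0 < q := by positivity
  have hq1 : q ≤ 1 := le_trans (mul_le_mul_of_nonneg_left (hβ 0 h0R) hγ.le) (hγβ 0 h0R)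
  -- `k₁` and `k₂` bound `‖z‖ + |u - u₀|` through `‖Λ z‖` and `|e|`: since `β ≥ m > 0`, the input is
  -- recovered from `z` and `e`.
  set k₁ := 1 / p + l₀ / m / p with hk₁
  set k₂ := 1 / m with hk₂
  have hk₁0 : 0 < k₁ := by positivity
  have hk₂0 : 0 < k₂ := by positivity
  set D₁ := l * c₁ + M * k₂ with hD₁
  set D₂ := l * c₁ / p + M * k₁ with hD₂
  have hD₁0 : 0 < D₁ := by positivity
  have hD₂0 : 0 < D₂ := by positivity
  set c := c₁ + D₂ + M with hc
  have hc0 : 0 < c := by positivity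
  set μ := 4 * c / q with hμ
  have hμ0 : 0 < μ := by positivity
  -- The sampling step contracts at rate `a / 2 = 2 * ν`; half of this is spent on the coupling.
  set ν := a / 4 with hν
  have hν0 : 0 < ν := by positivity
  clear_value q k₁ k₂ D₁ D₂ c μ ν
  -- The three summands serve the recursion for the fast mode, the offset in the composite
  -- recursion, and the bound between samples.
  refine ⟨c + μ * c + ((1 + c₁) / p + c₁ / μ), by positivity, ν, hν0, μ, hμ0, q / 2,
    by positivity, by linarith,
    min (min τ₁ (q / 4 / ν)) (min (min 1 (ν / (μ * c))) (q / 2 / D₁)), by positivity, ?_, ?_⟩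
  · calc ν * _ ≤ ν * (q / 4 / ν) :=
        mul_le_mul_of_nonneg_left ((min_le_left _ _).trans (min_le_right _ _)) hν0.le
      _ = q / 4 := by field_simp
      _ ≤ 1 := by linarith
  intro T hT δ s u u' ε z hδ hu hz hzR hu' hε
  have hT0 : 0 < T := hT.1
  have hTτ : T ≤ τ₁ := hT.2.trans ((min_le_left _ _).trans (min_le_left _ _))
  have hTν : ν * T ≤ q / 4 := by
    have : T ≤ q / 4 / ν := hT.2.trans ((min_le_left _ _).trans (min_le_right _ _))
    rw [le_div_iff₀ hν0] at this; linarith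
  have hT1 : T ≤ 1 :=
    hT.2.trans ((min_le_right _ _).trans ((min_le_left _ _).trans (min_le_left _ _)))
  have hTμ : μ * c * T ≤ ν := by
    have : T ≤ ν / (μ * c) :=
      hT.2.trans ((min_le_right _ _).trans ((min_le_left _ _).trans (min_le_right _ _)))
    rw [le_div_iff₀ (by positivity)] at this; linarith
  have hTD : D₁ * T ≤ q / 2 := by
    have : T ≤ q / 2 / D₁ := hT.2.trans ((min_le_right _ _).trans (min_le_right _ _))
    rw [le_div_iff₀ hD₁0] at this; linarith
  have hs : s ∈ Set.Icc s (s + T) := ⟨le_rfl, by linarith⟩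
  have hsT : s + T ∈ Set.Icc s (s + T) := ⟨by linarith, le_rfl⟩
  obtain ⟨hexc, hN'⟩ := hstep T ⟨hT0, hTτ⟩ s u z hu hz hzR
  set e := G (z s) - β (z s) * u with he
  set e' := G (z (s + T)) - β (z (s + T)) * u' with he'
  set N := ‖Λ (z s)‖ with hN
  have hN0 : 0 ≤ N := norm_nonneg _
  have he0 : 0 ≤ |e| := abs_nonneg _
  have hzN : ‖z s‖ ≤ N / p := by
    rw [le_div_iff₀ hp]; linarith [hΛ (z s)]
  clear_value e e' N
  have huu : |u - u₀| ≤ l₀ / m / p * N + k₂ * |e| := by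
    have h1 := hu₀ (z s) u (hzR s hs)
    rw [← he] at h1
    have h2 : l₀ * ‖z s‖ ≤ l₀ * (N / p) := by gcongr
    have h3 : |u - u₀| ≤ (l₀ * (N / p) + |e|) / m := by
      rw [le_div_iff₀ hm]; linarith
    refine h3.trans (le_of_eq ?_)
    rw [hk₂]; field_simp
  have hε' : |ε| ≤ M * T * (k₁ * N + k₂ * |e|) + M * δ := by
    refine hε.trans ?_
    have : ‖z s‖ + |u - u₀| ≤ k₁ * N + k₂ * |e| := by
      calc ‖z s‖ + |u - u₀| ≤ N / p + (l₀ / m / p * N + k₂ * |e|) := add_le_add hzN huu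
        _ = _ := by rw [hk₁]; ring
    gcongr
  have hlip : |(G (z (s + T)) - β (z (s + T)) * u) - e| ≤ l * c₁ * T * (N / p + |e|) := by
    have h1 := hl u hu _ _ (hzR _ hsT) (hzR _ hs)
    rw [← he] at h1
    refine h1.trans ?_
    calc l * ‖z (s + T) - z s‖ ≤ l * (c₁ * T * (‖z s‖ + |e|)) :=
          mul_le_mul_of_nonneg_left (hexc _ hsT) hl0
      _ ≤ l * (c₁ * T * (N / p + |e|)) := by gcongr
      _ = _ := by ring
  have hγ1 := hγβ _ (hzR _ hsT)
  have hγ2 : q ≤ γ * β (z (s + T)) :=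
    hq ▸ mul_le_mul_of_nonneg_left (hβ _ (hzR _ hsT)) hγ.le
  have hE' : |e'| ≤ (1 - q / 2) * |e| + c * T * N + c * δ := by
    -- Variation of `e` with frozen input, plus the effect of the update. The gain factor is
    -- evaluated at the end of the interval, where the new input takes effect.
    have h1 : e' = ((G (z (s + T)) - β (z (s + T)) * u) - e) + (1 - γ * β (z (s + T))) * e -
        γ * β (z (s + T)) * ε := by
      rw [he', hu']; ring
    have h2 : |e'| ≤ |(G (z (s + T)) - β (z (s + T)) * u) - e| +
        |(1 - γ * β (z (s + T))) * e| + |γ * β (z (s + T)) * ε| := by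
      rw [h1]
      exact (abs_sub _ _).trans (add_le_add (abs_add_le _ _) le_rfl)
    have h3 : |(1 - γ * β (z (s + T))) * e| ≤ (1 - q) * |e| := by
      rw [abs_mul, abs_of_nonneg (by linarith)]
      gcongr
    have h4 : |γ * β (z (s + T)) * ε| ≤ |ε| := by
      rw [abs_mul, abs_of_nonneg (by linarith)]
      exact mul_le_of_le_one_left (abs_nonneg _) hγ1
    have h5 : D₁ * T * |e| ≤ q / 2 * |e| := by gcongr
    have h6 : D₂ * T * N ≤ c * T * N := by gcongr; linarith
    have h7 : M * δ ≤ c * δ := by gcongr; linarith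
    have h8 : l * c₁ * T * (N / p + |e|) + M * T * (k₁ * N + k₂ * |e|) =
        D₁ * T * |e| + D₂ * T * N := by rw [hD₁, hD₂]; ring
    linarith
  have hmain := slow_fast_comparison (a := ν) (δ := δ) hc0 hq0 hT0 hN0 he0
    (hμ ▸ hTμ) hTν
    (N' := ‖Λ (z (s + T))‖) (by
      have : c₁ * T * |e| ≤ c * T * |e| := by gcongr; linarith
      have h2 : 2 * ν = a / 2 := by rw [hν]; ring
      rw [h2]
      linarith) hE'
  rw [← hμ] at hmain
  have hx1 : 0 ≤ μ * c := by positivity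
  have hx2 : 0 ≤ (1 + c₁) / p + c₁ / μ := by positivity
  refine ⟨hmain.trans ?_, hE'.trans ?_, ?_⟩
  · gcongr
    linarith
  · gcongr <;> linarith
  · intro t ht
    have h1 : ‖z t‖ ≤ ‖z s‖ + c₁ * T * (‖z s‖ + |e|) := by
      have := norm_add_le (z t - z s) (z s)
      rw [sub_add_cancel] at this
      linarith [hexc t ht]
    have h2 : c₁ * T * ‖z s‖ ≤ c₁ * 1 * ‖z s‖ := by gcongr
    have h3 : (1 + c₁) * ‖z s‖ ≤ (1 + c₁) * (N / p) := by gcongr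
    have h4 : c₁ / μ * (μ * T * |e|) = c₁ * T * |e| := by field_simp
    have h5 : 0 ≤ c₁ / μ * N := by positivity
    have h6 : 0 ≤ (1 + c₁) / p * (μ * T * |e|) := by positivity
    calc ‖z t‖ ≤ ((1 + c₁) / p + c₁ / μ) * (N + μ * T * |e|) := by
          have h7 : (1 + c₁) * (N / p) = (1 + c₁) / p * N := by ring
          have h8 : ((1 + c₁) / p + c₁ / μ) * (N + μ * T * |e|) = (1 + c₁) / p * N +
              (1 + c₁) / p * (μ * T * |e|) + c₁ / μ * N + c₁ / μ * (μ * T * |e|) := by ring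
          linarith
      _ ≤ _ := mul_le_mul_of_nonneg_right (by linarith) (by positivity)

set_option maxHeartbeats 1000000 in
/-- Semiglobal practical stability of the sampled closed loop in linearizing coordinates. -/
theorem exists_closedLoop_invariance (A : E →L[ℝ] E) (b : E) (Λ : E →L[ℝ] E') (G β : E → ℝ)
    {a τ p u₀ : ℝ} (hp : 0 < p) (hΛ : ∀ z, p * ‖z‖ ≤ ‖Λ z‖) (ha : 0 < a)
    (hτ : 0 < τ) (hLyap : ∀ T ∈ Set.Ioc 0 τ, ∀ z, ‖Λ (z + T • A z)‖ ≤ (1 - a * T) * ‖Λ z‖)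
    (hG : ∀ R, ∃ l, 0 ≤ l ∧ ∀ z w, ‖z‖ ≤ R → ‖w‖ ≤ R → |G z - G w| ≤ l * ‖z - w‖)
    (hβ : ∀ R, ∃ l, 0 ≤ l ∧ ∀ z w, ‖z‖ ≤ R → ‖w‖ ≤ R → |β z - β w| ≤ l * ‖z - w‖)
    (hβpos : ∀ R, ∃ m > 0, ∀ z, ‖z‖ ≤ R → m ≤ β z) (hu₀ : G 0 - β 0 * u₀ = 0)
    (ρ : ℕ) (hρ : 1 ≤ ρ) (ustar : ℕ → ℝ) {R₀ : ℝ} (hR₀ : 0 ≤ R₀) :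
    ∃ R > 0, ∀ γ > 0, (∀ z, ‖z‖ ≤ R → γ * β z ≤ 1) → ∃ U : ℝ, ∃ B : ℝ, ∀ M > 0,
      ∃ C > 0, ∃ ν > 0, ∃ b₁ > 0, ∃ τ' > 0, ν * τ' ≤ 1 ∧ ∀ T ∈ Set.Ioc 0 τ', ∀ δ ∈ Set.Icc 0 b₁,
      ∀ (N : ℕ) (u : ℕ → ℝ) (ε : ℕ → ℝ) (z : ℝ → E), ‖z 0‖ ≤ R₀ →
      (∀ k < N, SolvesOn (fun w => A w - (G w - β w * u k) • b) z (k * T) T) →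
      (∀ k ≤ N, k < ρ → u k = ustar k) →
      (∀ k < N, ρ ≤ k + 1 →
        u (k + 1) = u k + γ * ((G (z (k * T)) - β (z (k * T)) * u k) + ε k)) →
      (∀ k < N, ρ ≤ k + 1 →
        (∀ j ≤ k, |u j| ≤ U ∧ ∀ t ∈ Set.Icc (j * T) (j * T + T), ‖z t‖ ≤ R) →
        |ε k| ≤ M * T * (‖z (k * T)‖ + |u k - u₀|) + M * δ) →
      (∀ k ≤ N, ‖z (k * T)‖ ≤ R ∧ |u k| ≤ U ∧ |G (z (k * T)) - β (z (k * T)) * u k| ≤ B) ∧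
        (∀ k < N, ∀ t ∈ Set.Icc (k * T) (k * T + T), ‖z t‖ ≤ R) ∧
        ∀ k < N, ρ ≤ k + 1 → ∀ t ∈ Set.Icc (k * T) (k * T + T),
          ‖z t‖ ≤ C * ((1 - ν * T) ^ (k + 1 - ρ) + δ) := by
  -- `Nb` bounds the composite function when feedback starts: start-up moves `z` by at most `1`, and
  -- `μ * T * |e| ≤ 1`. The noise adds at most `1` to it later. `R₁` thus bounds `z` at the sampling
  -- instants in both phases, and `R = R₁ + 1` leaves room for the motion in between. None of these
  -- depends on `γ` or `M`.
  set Nb : ℝ := ‖Λ‖ * (R₀ + 1) + 1 with hNb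
  have hNb0 : 0 < Nb := by positivity
  set R₁ : ℝ := (Nb + 1) / p + (R₀ + 1) with hR₁
  have hR₁0 : 0 < R₁ := by positivity
  refine ⟨R₁ + 1, by positivity, ?_⟩
  set R := R₁ + 1 with hR
  have hR0 : 0 < R := by positivity
  have h0R : ‖(0 : E)‖ ≤ R := by simpa using hR0.le
  intro γ hγ hγβ
  obtain ⟨lG, hlG0, hlG⟩ := hG R
  obtain ⟨lβ, hlβ0, hlβ⟩ := hβ R
  obtain ⟨m, hm, hmβ⟩ := hβpos R
  have hGs : ∀ z, ‖z‖ ≤ R → |G z| ≤ |G 0| + lG * R := by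
    intro z hz
    have h1 := hlG z 0 hz h0R
    have h2 : lG * ‖z - 0‖ ≤ lG * R := by rw [sub_zero]; gcongr
    have h3 := abs_sub_abs_le_abs_sub (G z) (G 0)
    linarith
  have hβs : ∀ z, ‖z‖ ≤ R → |β z| ≤ |β 0| + lβ * R := by
    intro z hz
    have h1 := hlβ z 0 hz h0R
    have h2 : lβ * ‖z - 0‖ ≤ lβ * R := by rw [sub_zero]; gcongr
    have h3 := abs_sub_abs_le_abs_sub (β z) (β 0)
    linarith
  set Gs := |G 0| + lG * R with hGsd
  set βs := |β 0| + lβ * R with hβsd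
  have hGs0 : 0 ≤ Gs := by positivity
  have hβs0 : 0 ≤ βs := by positivity
  clear_value Gs βs
  have hes : ∀ z u, ‖z‖ ≤ R → |G z - β z * u| ≤ Gs + βs * |u| := by
    intro z u hz
    refine (abs_sub _ _).trans ?_
    rw [abs_mul]
    have := hβs z hz
    have := hGs z hz
    gcongr
  set us := ∑ j ∈ Finset.range ρ, |ustar j| with hus
  have hus0 : 0 ≤ us := Finset.sum_nonneg fun _ _ => abs_nonneg _
  -- Bounds `e` for every start-up input; the summand `1` gives `q ≤ q * B`, which closes the
  -- induction on `|e|`.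
  set B := 1 + Gs + βs * us with hB
  have hB1 : 1 ≤ B := by have : 0 ≤ βs * us := by positivity
                         linarith
  set l₀ := lG + lβ * |u₀| with hl₀
  have hl₀0 : 0 ≤ l₀ := by positivity
  have hu₀' : ∀ z u, ‖z‖ ≤ R → m * |u - u₀| ≤ l₀ * ‖z‖ + |G z - β z * u| := by
    intro z u hz
    have h1 := hlG z 0 hz h0R
    have h2 := hlβ z 0 hz h0R
    rw [sub_zero] at h1 h2
    have h3 : β z * (u - u₀) = (G z - G 0) - (β z - β 0) * u₀ - (G z - β z * u) := by
      linear_combination hu₀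
    calc m * |u - u₀| ≤ β z * |u - u₀| := by gcongr; exact hmβ z hz
      _ = |β z * (u - u₀)| := by rw [abs_mul, abs_of_pos (hm.trans_le (hmβ z hz))]
      _ ≤ |G z - G 0| + |β z - β 0| * |u₀| + |G z - β z * u| := by
          rw [h3, ← abs_mul]
          exact (abs_sub _ _).trans (add_le_add (abs_sub _ _) le_rfl)
      _ ≤ lG * ‖z‖ + lβ * ‖z‖ * |u₀| + |G z - β z * u| := by gcongr
      _ = _ := by rw [hl₀]; ring
  set U := |u₀| + (l₀ * R + B) / m with hU
  have hU0 : 0 ≤ U := by positivity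
  have huU : ∀ z u, ‖z‖ ≤ R → |G z - β z * u| ≤ B → |u| ≤ U := by
    intro z u hz he
    have h1 := hu₀' z u hz
    have h2 : l₀ * ‖z‖ ≤ l₀ * R := by gcongr
    have h3 : |u - u₀| ≤ (l₀ * R + B) / m := by
      rw [le_div_iff₀ hm]; linarith
    have h4 := abs_sub_abs_le_abs_sub u u₀
    linarith
  refine ⟨U, B, ?_⟩
  intro M hM
  have hl : ∀ u, |u| ≤ U → ∀ z w, ‖z‖ ≤ R → ‖w‖ ≤ R →
      |(G z - β z * u) - (G w - β w * u)| ≤ (lG + lβ * U) * ‖z - w‖ := by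
    intro u hu z w hz hw
    have h1 := hlG z w hz hw
    have h2 := hlβ z w hz hw
    calc |(G z - β z * u) - (G w - β w * u)| = |(G z - G w) - (β z - β w) * u| := by
          congr 1; ring
      _ ≤ |G z - G w| + |β z - β w| * |u| := by rw [← abs_mul]; exact abs_sub _ _
      _ ≤ lG * ‖z - w‖ + lβ * ‖z - w‖ * U := by gcongr
      _ = _ := by ring
  obtain ⟨c, hc, ν, hν, μ, hμ, q, hq, hq1, τ₁, hτ₁, hντ, hstep⟩ :=
    exists_closedLoop_step_bound A b Λ G β hp hΛ ha hτ hLyap (by positivity) hl hγ hm hmβ hγβ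
      hl₀0 hu₀' hM
  set L := ‖A‖ * R + (Gs + βs * U) * ‖b‖ + 1 with hL
  have hL0 : 0 < L := by positivity
  -- `C₂ * δ` is the fixed point of the recursion `W ↦ (1 - ν * T) * W + c * T * δ`.
  set C₂ := c / ν with hC₂
  have hC₂0 : 0 < C₂ := by positivity
  clear_value C₂ L U l₀ B us R R₁ Nb
  refine ⟨c * (Nb + C₂), by positivity, ν, hν, min (1 / C₂) (q / (2 * c)), by positivity,
    min (min τ₁ (1 / (ρ * L))) (min (1 / (μ * B)) (q / (2 * c * (Nb + 1)))), ?_, ?_, ?_⟩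
  · have : (0 : ℝ) < ρ := by exact_mod_cast hρ
    have : 0 < B := by linarith
    positivity
  · exact (mul_le_mul_of_nonneg_left ((min_le_left _ _).trans (min_le_left _ _)) hν.le).trans hντ
  intro T hT δ hδ N u ε z hz0 hsol hust hupd hε
  have hT0 : 0 < T := hT.1
  have hρ1 : (1 : ℝ) ≤ ρ := by exact_mod_cast hρ
  have hTτ : T ≤ τ₁ := hT.2.trans ((min_le_left _ _).trans (min_le_left _ _))
  have hTL : ρ * (L * T) ≤ 1 := by
    have : T ≤ 1 / (ρ * L) := hT.2.trans ((min_le_left _ _).trans (min_le_right _ _))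
    rw [le_div_iff₀ (by positivity)] at this; linarith
  have hTL1 : L * T ≤ 1 := by
    have : L * T ≤ ρ * (L * T) := le_mul_of_one_le_left (by positivity) hρ1
    linarith
  have hTμ : μ * T * B ≤ 1 := by
    have : T ≤ 1 / (μ * B) := hT.2.trans ((min_le_right _ _).trans (min_le_left _ _))
    rw [le_div_iff₀ (by positivity)] at this; linarith
  have hTq : c * T * (Nb + 1) ≤ q / 2 := by
    have : T ≤ q / (2 * c * (Nb + 1)) := hT.2.trans ((min_le_right _ _).trans (min_le_right _ _))
    rw [le_div_iff₀ (by positivity)] at this; linarith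
  have hδC : C₂ * δ ≤ 1 := by
    have : δ ≤ 1 / C₂ := hδ.2.trans (min_le_left _ _)
    rw [le_div_iff₀ hC₂0] at this; linarith
  have hδq : c * δ ≤ q / 2 := by
    have : δ ≤ q / (2 * c) := hδ.2.trans (min_le_right _ _)
    rw [le_div_iff₀ (by positivity)] at this; linarith
  have hν0 : 0 ≤ 1 - ν * T := by linarith [mul_le_mul_of_nonneg_left hTτ hν.le]
  have hν1 : 1 - ν * T ≤ 1 := by have : 0 ≤ ν * T := by positivity
                                 linarith
  have hδ0 := hδ.1
  set e : ℕ → ℝ := fun k => G (z (k * T)) - β (z (k * T)) * u k with he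
  have hzW : ∀ k : ℕ, ‖Λ (z (k * T))‖ ≤ Nb + 1 → ‖z (k * T)‖ ≤ R₁ := by
    intro k hk
    have : ‖z (k * T)‖ ≤ (Nb + 1) / p := by
      rw [le_div_iff₀ hp]; linarith [hΛ (z (k * T))]
    rw [hR₁]; linarith
  have hexc : ∀ k < N, ‖z (k * T)‖ ≤ R₁ → |u k| ≤ U →
      (∀ t ∈ Set.Icc (k * T) (k * T + T), ‖z t‖ ≤ R) ∧
        ‖z (k * T + T)‖ ≤ ‖z (k * T)‖ + L * T := by
    intro k hk hzk huk
    have h1 := (hsol k hk).norm_sub_le_of_speed_lt hL0.le (fun w hw => by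
      have hwR : ‖w‖ ≤ R := by
        have := norm_add_le (w - z (k * T)) (z (k * T))
        rw [sub_add_cancel] at this
        linarith
      have he1 := hes w (u k) hwR
      calc ‖A w - (G w - β w * u k) • b‖ ≤ ‖A‖ * ‖w‖ + |G w - β w * u k| * ‖b‖ := by
            refine (norm_sub_le _ _).trans (add_le_add (A.le_opNorm _) ?_)
            rw [norm_smul, Real.norm_eq_abs]
        _ ≤ ‖A‖ * R + (Gs + βs * U) * ‖b‖ := by
            have : Gs + βs * |u k| ≤ Gs + βs * U := by gcongr
            gcongr
            linarith
        _ < L := by linarith) hTL1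
    have h2 : ∀ t ∈ Set.Icc (k * T) (k * T + T), ‖z t‖ ≤ ‖z (k * T)‖ + L * T := by
      intro t ht
      have h3 := h1 t ht
      have h4 : L * (t - k * T) ≤ L * T := by
        gcongr; linarith [ht.2]
      have := norm_add_le (z t - z (k * T)) (z (k * T))
      rw [sub_add_cancel] at this
      linarith
    exact ⟨fun t ht => (h2 t ht).trans (by linarith), h2 _ ⟨by linarith, le_rfl⟩⟩
  -- The two phases overlap at `k = ρ - 1`, where the input is still prescribed and the decay
  -- estimate begins, with exponent `0`.
  have hinv : ∀ k ≤ N, (∀ j < k, |u j| ≤ U ∧ ∀ t ∈ Set.Icc (j * T) (j * T + T), ‖z t‖ ≤ R) ∧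
      ‖z (k * T)‖ ≤ R₁ ∧ |e k| ≤ B ∧
      (k < ρ → ‖z (k * T)‖ ≤ R₀ + k * (L * T)) ∧
      (ρ ≤ k + 1 → ‖Λ (z (k * T))‖ + μ * T * |e k| ≤ (1 - ν * T) ^ (k + 1 - ρ) * Nb + C₂ * δ) := by
    have hearly : ∀ k ≤ N, k < ρ → ‖z (k * T)‖ ≤ R₀ + k * (L * T) →
        ‖z (k * T)‖ ≤ R₁ ∧ |e k| ≤ B ∧ (ρ ≤ k + 1 →
          ‖Λ (z (k * T))‖ + μ * T * |e k| ≤ (1 - ν * T) ^ (k + 1 - ρ) * Nb + C₂ * δ) := by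
      intro k hkN hkρ hzk
      have h1 : (k : ℝ) * (L * T) ≤ ρ * (L * T) := by
        have : (k : ℝ) ≤ ρ := by exact_mod_cast hkρ.le
        gcongr
      have h2 : ‖z (k * T)‖ ≤ R₀ + 1 := by linarith
      have h3 : 0 ≤ (Nb + 1) / p := by positivity
      have h4 : ‖z (k * T)‖ ≤ R₁ := by linarith
      have h5 : |ustar k| ≤ us :=
        hus ▸ Finset.single_le_sum (f := fun j => |ustar j|) (fun _ _ => abs_nonneg _)
          (Finset.mem_range.2 hkρ)
      have h6 : |e k| ≤ B := by
        refine (hes _ _ (h4.trans (by linarith))).trans ?_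
        rw [hust k hkN hkρ]
        have : βs * |ustar k| ≤ βs * us := by gcongr
        linarith
      refine ⟨h4, h6, fun hk => ?_⟩
      have h7 : k + 1 - ρ = 0 := by omega
      rw [h7, pow_zero, one_mul]
      have h8 : ‖Λ (z (k * T))‖ ≤ ‖Λ‖ * (R₀ + 1) :=
        (Λ.le_opNorm _).trans (mul_le_mul_of_nonneg_left h2 (norm_nonneg _))
      have h9 : μ * T * |e k| ≤ μ * T * B := by gcongr
      have h10 : 0 ≤ C₂ * δ := by positivity
      linarith
    intro k
    induction k with
    | zero =>
      intro hk
      have h0 : ‖z ((0 : ℕ) * T)‖ ≤ R₀ + (0 : ℕ) * (L * T) := by simpa using hz0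
      obtain ⟨h1, h2, h3⟩ := hearly 0 hk (by omega) h0
      exact ⟨fun j hj => absurd hj (by omega), h1, h2, fun _ => h0, h3⟩
    | succ k ih =>
      intro hk
      obtain ⟨hpast, hzk, hek, hfirst, hW⟩ := ih (by omega)
      have hkN : k < N := by omega
      have huk := huU _ _ (hzk.trans (by linarith)) hek
      obtain ⟨hball, hnext⟩ := hexc k hkN hzk huk
      have hcast : ((k + 1 : ℕ) : ℝ) * T = k * T + T := by push_cast; ring
      have hpast' : ∀ j < k + 1, |u j| ≤ U ∧ ∀ t ∈ Set.Icc (j * T) (j * T + T), ‖z t‖ ≤ R := by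
        intro j hj
        rcases Nat.lt_succ_iff_lt_or_eq.1 hj with hj | rfl
        · exact hpast j hj
        · exact ⟨huk, hball⟩
      refine ⟨hpast', ?_⟩
      by_cases hkρ : k + 1 < ρ
      · have h0 : ‖z ((k + 1 : ℕ) * T)‖ ≤ R₀ + (k + 1 : ℕ) * (L * T) := by
          rw [hcast]
          push_cast
          linarith [hfirst (by omega)]
        obtain ⟨h1, h2, h3⟩ := hearly (k + 1) hk hkρ h0
        exact ⟨h1, h2, fun _ => h0, h3⟩
      · have hρk : ρ ≤ k + 1 := by omega
        obtain ⟨hs1, hs2, -⟩ := hstep T ⟨hT0, hTτ⟩ δ (k * T) (u k) (u (k + 1)) (ε k) z hδ0 huk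
          (hsol k hkN) hball (hupd k hkN hρk)
          (hε k hkN hρk fun j hj => hpast' j (by omega))
        rw [← hcast] at hs1 hs2
        have hWk := hW hρk
        have hWk1 : ‖Λ (z (k * T))‖ ≤ Nb + 1 := by
          have h1 : (1 - ν * T) ^ (k + 1 - ρ) * Nb ≤ 1 * Nb := by
            gcongr
            exact pow_le_one₀ hν0 hν1
          have h2 : 0 ≤ μ * T * |e k| := by positivity
          linarith
        have hW' : ‖Λ (z ((k + 1 : ℕ) * T))‖ + μ * T * |e (k + 1)| ≤
            (1 - ν * T) ^ (k + 1 + 1 - ρ) * Nb + C₂ * δ := by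
          have h1 : k + 1 + 1 - ρ = (k + 1 - ρ) + 1 := by omega
          have h2 : (1 - ν * T) * (‖Λ (z (k * T))‖ + μ * T * |e k|) ≤
              (1 - ν * T) * ((1 - ν * T) ^ (k + 1 - ρ) * Nb + C₂ * δ) := by gcongr
          have h3 : ν * C₂ = c := by rw [hC₂]; field_simp
          rw [h1, pow_succ]
          have h4 : c * T * δ = ν * T * (C₂ * δ) := by rw [← h3]; ring
          refine hs1.trans ?_
          rw [h4]
          linarith
        have hW1 : ‖Λ (z ((k + 1 : ℕ) * T))‖ ≤ Nb + 1 := by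
          have h1 : (1 - ν * T) ^ (k + 1 + 1 - ρ) * Nb ≤ 1 * Nb := by
            gcongr
            exact pow_le_one₀ hν0 hν1
          have h2 : 0 ≤ μ * T * |e (k + 1)| := by positivity
          linarith
        refine ⟨hzW _ hW1, ?_, fun h => absurd h hkρ, fun _ => hW'⟩
        -- The composite function controls only `μ * T * |e|`, which is useless as `T → 0`. A bound
        -- on `|e|` uniform in `T` comes from the contraction of the fast mode itself.
        have h1 : (1 - q) * |e k| ≤ (1 - q) * B :=
          mul_le_mul_of_nonneg_left hek (by linarith)
        have h2 : c * T * ‖Λ (z (k * T))‖ ≤ c * T * (Nb + 1) := by gcongr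
        have h3 : q ≤ q * B := le_mul_of_one_le_right hq.le hB1
        have h4 : |e (k + 1)| ≤ (1 - q) * |e k| + c * T * ‖Λ (z (k * T))‖ + c * δ := hs2
        linarith
  have huk : ∀ k ≤ N, |u k| ≤ U := fun k hk => by
    obtain ⟨-, h1, h2, -⟩ := hinv k hk
    exact huU _ _ (h1.trans (by linarith)) h2
  have hball : ∀ k < N, ∀ t ∈ Set.Icc (k * T) (k * T + T), ‖z t‖ ≤ R := fun k hk =>
    (hexc k hk (hinv k hk.le).2.1 (huk k hk.le)).1
  refine ⟨fun k hk => ?_, hball, fun k hk hρk t ht => ?_⟩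
  · exact ⟨(hinv k hk).2.1.trans (by linarith), huk k hk, (hinv k hk).2.2.1⟩
  · obtain ⟨-, -, hs3⟩ := hstep T ⟨hT0, hTτ⟩ δ (k * T) (u k) (u (k + 1)) (ε k) z hδ0
      (huk k hk.le) (hsol k hk) (hball k hk) (hupd k hk hρk)
      (hε k hk hρk fun j hj => ⟨huk j (by omega), hball j (by omega)⟩)
    have hWk := (hinv k hk.le).2.2.2.2 hρk
    have hpow : 0 ≤ (1 - ν * T) ^ (k + 1 - ρ) := pow_nonneg hν0 _
    calc ‖z t‖ ≤ c * (‖Λ (z (k * T))‖ + μ * T * |e k|) := hs3 t ht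
      _ ≤ c * ((1 - ν * T) ^ (k + 1 - ρ) * Nb + C₂ * δ) := by gcongr
      _ ≤ c * ((1 - ν * T) ^ (k + 1 - ρ) * (Nb + C₂) + (Nb + C₂) * δ) := by
          gcongr <;> linarith
      _ = _ := by ring

end ClosedLoop

/-! ### Lyapunov norm and explicit Euler step -/

section Lyapunov

variable {n : ℕ}

/-- A positive definite matrix is the Gram matrix of an injective operator. -/
theorem Matrix.PosDef.exists_gram_operator {P : Matrix (Fin n) (Fin n) ℝ} (hP : P.PosDef) :
    ∃ Λ : EuclideanSpace ℝ (Fin n) →L[ℝ] EuclideanSpace ℝ (Fin n), ∃ p > 0,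
      (∀ x, p * ‖x‖ ≤ ‖Λ x‖) ∧
        ∀ x y, inner ℝ (Λ x) (Λ y) = inner ℝ x (Matrix.toEuclideanCLM (𝕜 := ℝ) P y) := by
  open scoped MatrixOrder Matrix.Norms.L2Operator in
  -- Positivity in the C⋆-algebra of matrices gives `P = B⋆ B`. Definiteness makes `B` injective,
  -- hence bounded below in finite dimension.
  obtain ⟨B, hB⟩ := CStarAlgebra.nonneg_iff_eq_star_mul_self.mp hP.posSemidef.nonneg
  have hinner : ∀ x y, inner ℝ (Matrix.toEuclideanCLM (𝕜 := ℝ) B x)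
      (Matrix.toEuclideanCLM (𝕜 := ℝ) B y) = inner ℝ x (Matrix.toEuclideanCLM (𝕜 := ℝ) P y) := by
    intro x y
    rw [hB, map_mul, map_star, ContinuousLinearMap.star_eq_adjoint,
      mul_apply_eq_comp, ContinuousLinearMap.adjoint_inner_right]
  have hker : LinearMap.ker (Matrix.toEuclideanCLM (𝕜 := ℝ) B).toLinearMap = ⊥ := by
    rw [LinearMap.ker_eq_bot']
    intro x hx
    by_contra hx0
    have h1 := hinner x x
    have h2 : Matrix.toEuclideanCLM (𝕜 := ℝ) B x = 0 := hx
    rw [h2, inner_zero_left] at h1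
    have h3 := hP.dotProduct_mulVec_pos (x := x.ofLp) (by simpa using hx0)
    rw [EuclideanSpace.inner_eq_star_dotProduct, Matrix.ofLp_toEuclideanCLM,
      dotProduct_comm] at h1
    exact h3.ne h1
  obtain ⟨k, hk0, hk⟩ := LinearMap.exists_antilipschitzWith _ hker
  refine ⟨Matrix.toEuclideanCLM (𝕜 := ℝ) B, (k : ℝ)⁻¹, by positivity, fun x => ?_, hinner⟩
  have h1 := hk.le_mul_dist x 0
  rw [inv_mul_le_iff₀ (by exact_mod_cast hk0)]
  simpa using h1

/-- The Lyapunov equation yields a norm that the explicit Euler step contracts. -/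
theorem exists_euler_contraction {A P Q : Matrix (Fin n) (Fin n) ℝ} (hP : P.PosDef)
    (hQ : Q.PosDef) (h : A.transpose * P + P * A = -Q) :
    ∃ Λ : EuclideanSpace ℝ (Fin n) →L[ℝ] EuclideanSpace ℝ (Fin n),
      ∃ p > 0, ∃ a > 0, ∃ τ > 0, (∀ x, p * ‖x‖ ≤ ‖Λ x‖) ∧ ∀ T ∈ Set.Ioc 0 τ, ∀ x,
        ‖Λ (x + T • Matrix.toEuclideanCLM (𝕜 := ℝ) A x)‖ ≤ (1 - a * T) * ‖Λ x‖ := by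
  obtain ⟨Λ, p, hp, hΛ, hΛP⟩ := hP.exists_gram_operator
  obtain ⟨Δ, d, hd, hΔ, hΔQ⟩ := hQ.exists_gram_operator
  set A' := Matrix.toEuclideanCLM (𝕜 := ℝ) A with hA'
  have hop : ∀ x, 2 * inner ℝ (Λ x) (Λ (A' x)) = -‖Δ x‖ ^ 2 := by
    intro x
    have h1 := congrArg (Matrix.toEuclideanCLM (𝕜 := ℝ)) h
    rw [map_add, map_mul, map_mul, map_neg, ← Matrix.conjTranspose_eq_transpose_of_trivial,
      ← Matrix.star_eq_conjTranspose, map_star, ContinuousLinearMap.star_eq_adjoint] at h1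
    have h2 := congrArg (fun S => inner ℝ x (S x)) h1
    simp only [add_apply, mul_apply_eq_comp,
      neg_apply, inner_add_right, inner_neg_right,
      ContinuousLinearMap.adjoint_inner_right] at h2
    rw [← hΛP, ← hΛP, ← hΔQ, real_inner_self_eq_norm_sq, real_inner_comm] at h2
    linarith
  set L := ‖Λ‖ + 1 with hL
  have hL0 : 0 < L := by positivity
  set k := (‖Λ‖ * ‖A'‖ / p) ^ 2 + 1 with hk
  have hk0 : 0 < k := by positivity
  set κ := d ^ 2 / L ^ 2 with hκ
  have hκ0 : 0 < κ := by positivity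
  -- The square of the new norm is at most `1 - κ T + k T² ≤ 1 - κ T / 2 ≤ (1 - κ T / 4)²` times the
  -- old one; `T ≤ 4 / κ` keeps the root nonnegative.
  refine ⟨Λ, p, hp, κ / 4, by positivity, min (4 / κ) (κ / 2 / k), by positivity, hΛ, ?_⟩
  intro T hT x
  have hT0 : 0 < T := hT.1
  have hT1 : κ / 4 * T ≤ 1 := by
    have : T ≤ 4 / κ := hT.2.trans (min_le_left _ _)
    rw [le_div_iff₀ hκ0] at this; linarith
  have hT2 : k * T ≤ κ / 2 := by
    have : T ≤ κ / 2 / k := hT.2.trans (min_le_right _ _)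
    rw [le_div_iff₀ hk0] at this; linarith
  have h1 : ‖Λ x‖ ≤ L * ‖x‖ := (Λ.le_opNorm x).trans (by gcongr; linarith)
  have h2 : κ * ‖Λ x‖ ^ 2 ≤ ‖Δ x‖ ^ 2 := by
    calc κ * ‖Λ x‖ ^ 2 ≤ κ * (L * ‖x‖) ^ 2 := by gcongr
      _ = (d * ‖x‖) ^ 2 := by rw [hκ]; field_simp
      _ ≤ _ := by gcongr; exact hΔ x
  have h3 : ‖Λ (A' x)‖ ^ 2 ≤ k * ‖Λ x‖ ^ 2 := by
    have h4 : ‖Λ (A' x)‖ ≤ ‖Λ‖ * ‖A'‖ / p * ‖Λ x‖ := by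
      calc ‖Λ (A' x)‖ ≤ ‖Λ‖ * (‖A'‖ * ‖x‖) :=
            (Λ.le_opNorm _).trans (by gcongr; exact A'.le_opNorm x)
        _ = ‖Λ‖ * ‖A'‖ / p * (p * ‖x‖) := by field_simp
        _ ≤ _ := by gcongr; exact hΛ x
    calc ‖Λ (A' x)‖ ^ 2 ≤ (‖Λ‖ * ‖A'‖ / p * ‖Λ x‖) ^ 2 := by gcongr
      _ = (‖Λ‖ * ‖A'‖ / p) ^ 2 * ‖Λ x‖ ^ 2 := by ring
      _ ≤ _ := by gcongr; linarith
  refine (sq_le_sq₀ (norm_nonneg _) (mul_nonneg (by linarith) (norm_nonneg _))).1 ?_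
  rw [map_add, map_smul, norm_add_sq_real, inner_smul_right, norm_smul, Real.norm_eq_abs,
    abs_of_pos hT0]
  have h5 := hop x
  have h6 : T * (κ * ‖Λ x‖ ^ 2) ≤ T * ‖Δ x‖ ^ 2 := by gcongr
  have h7 : T ^ 2 * ‖Λ (A' x)‖ ^ 2 ≤ T ^ 2 * (k * ‖Λ x‖ ^ 2) := by gcongr
  have h8 : (k * T) * (T * ‖Λ x‖ ^ 2) ≤ κ / 2 * (T * ‖Λ x‖ ^ 2) := by gcongr
  have h9 : 0 ≤ (κ / 4 * T) ^ 2 * ‖Λ x‖ ^ 2 := by positivity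
  have h10 : 2 * (T * inner ℝ (Λ x) (Λ (A' x))) = -(T * ‖Δ x‖ ^ 2) := by
    linear_combination T * h5
  linarith

end Lyapunov

/-! ### Linearizing coordinates -/

section Coordinates

variable {n : ℕ} {f g : EuclideanSpace ℝ (Fin n) → EuclideanSpace ℝ (Fin n)}
  {h : EuclideanSpace ℝ (Fin n) → ℝ}

theorem ContDiff.lieDeriv (hf : ContDiff ℝ ∞ f) (hh : ContDiff ℝ ∞ h) :
    ContDiff ℝ ∞ (lieDeriv f h) :=
  (hh.fderiv_right (m := ∞) (by simp)).clm_apply hf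

theorem ContDiff.iterate_lieDeriv (hf : ContDiff ℝ ∞ f) (hh : ContDiff ℝ ∞ h) (i : ℕ) :
    ContDiff ℝ ∞ ((_root_.lieDeriv f)^[i] h) := by
  induction i with
  | zero => exact hh
  | succ i ih => rw [Function.iterate_succ_apply']; exact hf.lieDeriv ih

theorem ContDiff.alphaFn (hf : ContDiff ℝ ∞ f) (hh : ContDiff ℝ ∞ h) :
    ContDiff ℝ ∞ (alphaFn f h) :=
  hf.iterate_lieDeriv hh n

theorem ContDiff.betaFn (hf : ContDiff ℝ ∞ f) (hg : ContDiff ℝ ∞ g) (hh : ContDiff ℝ ∞ h) :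
    ContDiff ℝ ∞ (betaFn f g h) :=
  hg.lieDeriv (hf.iterate_lieDeriv hh (n - 1))

/-- In the linearizing coordinates the system is a chain of integrators driven by the input
error. -/
theorem hasDerivWithinAt_linCoord (hf : ContDiff ℝ ∞ f) (hh : ContDiff ℝ ∞ h)
    (hrel : HasPosRelativeDegree f g h) (K : Fin n → ℝ) {x : ℝ → EuclideanSpace ℝ (Fin n)}
    {s : Set ℝ} {t u : ℝ} (hx : HasDerivWithinAt x (f (x t) + u • g (x t)) s t) :
    HasDerivWithinAt (fun t => linCoord f h (x t))
      (Matrix.toEuclideanCLM (𝕜 := ℝ) (chainA n + Matrix.vecMulVec (chainB n) K)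
        (linCoord f h (x t)) - inputError f g h K (x t) u • WithLp.toLp 2 (chainB n)) s t := by
  rw [hasDerivWithinAt_iff_hasFDerivWithinAt, hasFDerivWithinAt_euclidean]
  intro i
  have hdiff : HasFDerivAt ((lieDeriv f)^[(i : ℕ)] h)
      (fderiv ℝ ((lieDeriv f)^[(i : ℕ)] h) (x t)) (x t) :=
    ((hf.iterate_lieDeriv hh i).differentiable (by simp) _).hasFDerivAt
  have h1 := (hdiff.comp_hasDerivWithinAt t hx).hasFDerivWithinAt
  refine h1.congr_fderiv ?_
  ext
  have h2 : fderiv ℝ ((lieDeriv f)^[(i : ℕ)] h) (x t) (f (x t) + u • g (x t)) =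
      (lieDeriv f)^[(i : ℕ) + 1] h (x t) + u * lieDeriv g ((lieDeriv f)^[(i : ℕ)] h) (x t) := by
    rw [map_add, map_smul, Function.iterate_succ_apply', smul_eq_mul]
    rfl
  -- The feedback `K z` in the matrix cancels the one in the input error, leaving the open-loop
  -- chain driven by `α + β u`.
  have h3 : (Matrix.toEuclideanCLM (𝕜 := ℝ) (chainA n + Matrix.vecMulVec (chainB n) K)
        (linCoord f h (x t)) - inputError f g h K (x t) u • WithLp.toLp 2 (chainB n)) i =
      (chainA n).mulVec (fun j => linCoord f h (x t) j) i +
        chainB n i * (alphaFn f h (x t) + betaFn f g h (x t) * u) := by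
    rw [PiLp.sub_apply, PiLp.smul_apply, Matrix.ofLp_toEuclideanCLM, Matrix.add_mulVec,
      Pi.add_apply, Matrix.vecMulVec_mulVec]
    simp only [inputError, virtualInput, dotProduct, Pi.smul_apply, MulOpposite.smul_eq_mul_unop,
      MulOpposite.unop_op, smul_eq_mul]
    ring
  have h4 : (lieDeriv f)^[(i : ℕ) + 1] h (x t) +
      u * lieDeriv g ((lieDeriv f)^[(i : ℕ)] h) (x t) =
      (chainA n).mulVec (fun j => linCoord f h (x t) j) i +
        chainB n i * (alphaFn f h (x t) + betaFn f g h (x t) * u) := by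
    -- Only the last coordinate sees the input; in the others the relative degree condition removes
    -- it.
    by_cases hi : (i : ℕ) + 1 = n
    · have h5 : (chainA n).mulVec (fun j => linCoord f h (x t) j) i = 0 := by
        rw [Matrix.mulVec, dotProduct]
        refine Finset.sum_eq_zero fun j _ => ?_
        have : ¬ (j : ℕ) = i + 1 := by have := j.2; omega
        simp [chainA, this]
      have h6 : (i : ℕ) = n - 1 := by omega
      rw [h5, chainB, if_pos hi, alphaFn, betaFn, hi, ← h6]
      ring
    · have hi' : (i : ℕ) + 1 < n := by have := i.2; omega
      have h5 : (chainA n).mulVec (fun j => linCoord f h (x t) j) i =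
          (lieDeriv f)^[(i : ℕ) + 1] h (x t) := by
        rw [Matrix.mulVec, dotProduct, Finset.sum_eq_single ⟨i + 1, hi'⟩]
        · simp [chainA, linCoord]
        · intro j _ hj
          have : ¬ (j : ℕ) = i + 1 := fun h => hj (Fin.ext h)
          simp [chainA, this]
        · simp
      rw [h5, chainB, if_neg hi, hrel.1 i (by omega) (x t)]
      ring
  simpa using h2.trans (h4.trans h3.symm)

end Coordinates

/-! ### Existence and continuation of solutions -/

/-- Solutions of a control-affine system with bounded constant inputs, starting in a ball, exist
on a common time interval. -/
theorem exists_uniform_local_solution {E : Type*} [NormedAddCommGroup E] [NormedSpace ℝ E]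
    [FiniteDimensional ℝ E] {f g : E → E} (hf : ContDiff ℝ ∞ f) (hg : ContDiff ℝ ∞ g) (r U : ℝ) :
    ∃ τ > 0, ∀ T ∈ Set.Ioc 0 τ, ∀ (s u : ℝ) (x₀ : E), ‖x₀‖ ≤ r → |u| ≤ U →
      ∃ y : ℝ → E, y s = x₀ ∧ SolvesOn (fun w => f w + u • g w) y s T := by
  have : ProperSpace E := FiniteDimensional.proper ℝ E
  have hcomp := isCompact_closedBall (0 : E) (r + 1)
  have hconv := convex_closedBall (0 : E) (r + 1)
  obtain ⟨Kf, hKf⟩ := hf.contDiffOn.exists_lipschitzOnWith (s := Metric.closedBall 0 (r + 1))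
    (by simp) hconv hcomp
  obtain ⟨Kg, hKg⟩ := hg.contDiffOn.exists_lipschitzOnWith (s := Metric.closedBall 0 (r + 1))
    (by simp) hconv hcomp
  obtain ⟨Cf, hCf⟩ := hcomp.exists_bound_of_continuousOn hf.continuous.continuousOn
  obtain ⟨Cg, hCg⟩ := hcomp.exists_bound_of_continuousOn hg.continuous.continuousOn
  set L : NNReal := Real.toNNReal (Cf + U * Cg) with hL
  -- `L` bounds the speed on the ball of radius `r + 1`, so during this time the solution stays in
  -- the unit ball around `x₀`, for all admissible `x₀` and `u`.
  refine ⟨1 / (L + 1), by positivity, ?_⟩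
  intro T hT s u x₀ hx₀ hu
  have hT0 : 0 < T := hT.1
  have hT1 : L * T ≤ 1 := by
    have := hT.2
    rw [le_div_iff₀ (by positivity)] at this
    linarith
  have hU0 : 0 ≤ U := (abs_nonneg u).trans hu
  have hsub : Metric.closedBall x₀ ((1 : NNReal) : ℝ) ⊆ Metric.closedBall 0 (r + 1) := by
    refine Metric.closedBall_subset_closedBall' ?_
    rw [dist_zero_right, NNReal.coe_one]; linarith
  have hPL : IsPicardLindelof (fun _ w => f w + u • g w) (tmin := s) (tmax := s + T)
      ⟨s, le_rfl, by linarith⟩ x₀ 1 0 L (Kf + Real.toNNReal U * Kg) := by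
    refine IsPicardLindelof.of_time_independent ?_ ?_ ?_
    · intro w hw
      have hw' := hsub hw
      have h1 : ‖f w + u • g w‖ ≤ Cf + U * Cg := by
        refine (norm_add_le _ _).trans (add_le_add (hCf w hw') ?_)
        rw [norm_smul, Real.norm_eq_abs]
        exact mul_le_mul hu (hCg w hw') (norm_nonneg _) hU0
      exact h1.trans (Real.le_coe_toNNReal _)
    · refine LipschitzOnWith.of_dist_le_mul fun w hw w' hw' => ?_
      have h1 := hKf.dist_le_mul w (hsub hw) w' (hsub hw')
      have h2 := hKg.dist_le_mul w (hsub hw) w' (hsub hw')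
      calc dist (f w + u • g w) (f w' + u • g w')
          ≤ dist (f w) (f w') + dist (u • g w) (u • g w') := dist_add_add_le _ _ _ _
        _ = dist (f w) (f w') + |u| * dist (g w) (g w') := by
            rw [dist_smul₀, Real.norm_eq_abs]
        _ ≤ Kf * dist w w' + U * (Kg * dist w w') := by gcongr
        _ = _ := by
            rw [NNReal.coe_add, NNReal.coe_mul, Real.coe_toNNReal _ hU0]; ring
    · simpa [hT0.le] using hT1
  obtain ⟨y, hy0, hy⟩ := hPL.exists_eq_forall_mem_Icc_hasDerivWithinAt₀
  refine ⟨y, hy0, fun t ht => (hy t ht).continuousWithinAt, fun t ht => ?_⟩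
  exact (hy t (Set.Ico_subset_Icc_self ht)).mono_of_mem_nhdsWithin (Icc_mem_nhdsGE_of_mem ht)

section ClosedLoop

variable {n : ℕ} {f g : EuclideanSpace ℝ (Fin n) → EuclideanSpace ℝ (Fin n)}
  {h : EuclideanSpace ℝ (Fin n) → ℝ} {K : Fin n → ℝ} {γ : ℝ} {ρ : ℕ} {ustar : ℕ → ℝ}
  {est : Estimator n} {T : ℝ} {d : ℝ → ℝ} {x₀ : EuclideanSpace ℝ (Fin n)}

theorem IsSampledSolution.solvesOn {N : ℕ} {u : ℕ → ℝ} {x : ℝ → EuclideanSpace ℝ (Fin n)}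
    (hT : 0 < T) (hx : IsSampledSolution f g T N u x) {j : ℕ} (hj : j < N) :
    SolvesOn (fun w => f w + u j • g w) x (j * T) T := by
  have hcast : (j : ℝ) * T + T = ((j : ℝ) + 1) * T := by ring
  refine ⟨hx.1.mono (Set.Icc_subset_Icc (by positivity) ?_), fun t ht => ?_⟩
  · have : (j : ℝ) + 1 ≤ N := by exact_mod_cast hj
    rw [hcast]; gcongr
  · rw [hcast] at ht
    exact hx.2 j hj t ht

/-- The closed loop on the first `N` sampling intervals only depends on the data there. -/
theorem IsClosedLoop.congr {N : ℕ} {u u' : ℕ → ℝ} {x x' : ℝ → EuclideanSpace ℝ (Fin n)}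
    (hT : 0 < T) (hcausal : est.IsCausal)
    (hx : IsClosedLoop f g h K γ ρ ustar est T d x₀ N u x) (hu : ∀ j < N, u' j = u j)
    (hxx : ∀ t ∈ Set.Icc 0 ((N : ℝ) * T), x' t = x t) :
    IsClosedLoop f g h K γ ρ ustar est T d x₀ N u' x' := by
  obtain ⟨h0, ⟨hcont, hder⟩, hust, hupd⟩ := hx
  refine ⟨?_, ⟨hcont.congr hxx, fun j hj t ht => ?_⟩, fun k hk hkρ => ?_, fun k hk hkρ => ?_⟩
  · rw [hxx 0 ⟨le_rfl, by positivity⟩, h0]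
  · have htN : t ∈ Set.Ico 0 ((N : ℝ) * T) := by
      refine ⟨le_trans (by positivity) ht.1, ht.2.trans_le ?_⟩
      have : (j : ℝ) + 1 ≤ N := by exact_mod_cast hj
      gcongr
    have htt := hxx t (Set.Ico_subset_Icc_self htN)
    rw [hu j hj, htt]
    refine (hder j hj t ht).congr_of_eventuallyEq ?_ htt
    filter_upwards [Icc_mem_nhdsGE_of_mem htN] with y hy using hxx y hy
  · rw [hu k hk, hust k hk hkρ]
  · have hest : est T (fun t => h (x' t) + d t) u' k = est T (fun t => h (x t) + d t) u k := by
      refine hcausal T _ _ _ _ k hT (fun t ht => ?_) (fun j hj => hu j (by omega))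
      have : (k : ℝ) + 1 ≤ N := by exact_mod_cast hk.le
      have h1 : t ∈ Set.Icc 0 ((N : ℝ) * T) := ⟨ht.1, ht.2.trans (by gcongr)⟩
      simp only [hxx t h1]
    rw [hest, hu _ hk, hu k (by omega), hupd k hk hkρ]

theorem IsClosedLoop.mono {N M : ℕ} {u : ℕ → ℝ} {x : ℝ → EuclideanSpace ℝ (Fin n)}
    (hT : 0 ≤ T) (hx : IsClosedLoop f g h K γ ρ ustar est T d x₀ N u x) (hM : M ≤ N) :
    IsClosedLoop f g h K γ ρ ustar est T d x₀ M u x := by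
  obtain ⟨h0, ⟨hcont, hder⟩, hust, hupd⟩ := hx
  have hMN : (M : ℝ) ≤ N := by exact_mod_cast hM
  exact ⟨h0, ⟨hcont.mono (Set.Icc_subset_Icc le_rfl (by gcongr)),
    fun j hj => hder j (by omega)⟩, fun k hk => hust k (by omega), fun k hk => hupd k (by omega)⟩

/-- Extension of the closed loop by one sampling interval. -/
theorem IsClosedLoop.extend {N : ℕ} {u : ℕ → ℝ} {x y : ℝ → EuclideanSpace ℝ (Fin n)}
    (hT : 0 < T) (hcausal : est.IsCausal)
    (hx : IsClosedLoop f g h K γ ρ ustar est T d x₀ N u x)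
    (hust : N < ρ → u N = ustar N)
    (hupd : ∀ k, k + 1 = N → ρ ≤ N → u N = u k + γ * (virtualInput K
      (fun i => est T (fun t => h (x t) + d t) u k (Fin.castSucc i)) -
        est T (fun t => h (x t) + d t) u k (Fin.last n)))
    (hy0 : y (N * T) = x (N * T)) (hy : SolvesOn (fun w => f w + u N • g w) y (N * T) T) :
    IsClosedLoop f g h K γ ρ ustar est T d x₀ (N + 1) u
      (fun t => if t ≤ N * T then x t else y t) := by
  set x' : ℝ → EuclideanSpace ℝ (Fin n) := fun t => if t ≤ N * T then x t else y t with hx'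
  have hx1 : ∀ t ≤ (N : ℝ) * T, x' t = x t := fun t ht => if_pos ht
  have hx2 : ∀ t, (N : ℝ) * T ≤ t → x' t = y t := by
    intro t ht
    rcases ht.eq_or_lt with rfl | ht
    · rw [hx1 _ le_rfl, hy0]
    · exact if_neg (not_le.2 ht)
  have hxx : ∀ t ∈ Set.Icc 0 ((N : ℝ) * T), x' t = x t := fun t ht => hx1 t ht.2
  obtain ⟨h0, ⟨hcont, hder⟩, hust', hupd'⟩ := hx.congr hT hcausal (fun _ _ => rfl) hxx
  have hcast : ((N + 1 : ℕ) : ℝ) * T = N * T + T := by push_cast; ring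
  refine ⟨h0, ⟨?_, fun j hj t ht => ?_⟩, fun k hk hkρ => ?_, fun k hk hkρ => ?_⟩
  · rw [hcast, ← Set.Icc_union_Icc_eq_Icc (b := (N : ℝ) * T) (by positivity) (by linarith)]
    exact hcont.union_of_isClosed (hy.1.congr fun t ht => hx2 t ht.1) isClosed_Icc isClosed_Icc
  · rcases Nat.lt_succ_iff_lt_or_eq.1 hj with hj | rfl
    · exact hder j hj t ht
    · have ht' : t ∈ Set.Ico ((j : ℝ) * T) (j * T + T) := ⟨ht.1, by linarith [ht.2]⟩
      rw [hx2 t ht.1]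
      refine (hy.2 t ht').congr (fun s hs => hx2 s (ht.1.trans hs)) (hx2 t ht.1)
  · rcases Nat.lt_succ_iff_lt_or_eq.1 hk with hk | rfl
    · exact hust' k hk hkρ
    · exact hust hkρ
  · rcases Nat.lt_succ_iff_lt_or_eq.1 hk with hk | hk
    · exact hupd' k hk hkρ
    · have hest : est T (fun t => h (x' t) + d t) u k = est T (fun t => h (x t) + d t) u k := by
        refine hcausal T _ _ _ _ k hT (fun t ht => ?_) (fun j hj => rfl)
        have h1 : t ≤ (N : ℝ) * T := by
          rw [← hk]; push_cast; exact ht.2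
        simp only [hx1 t h1]
      rw [hest, hk]
      exact hupd k hk (by omega)

/-- If the closed loop can always be continued by one sampling interval, then it has a solution
on `[0, ∞)`. -/
theorem exists_isGlobalClosedLoop (hT : 0 < T) (hcausal : est.IsCausal)
    (hstep : ∀ (N : ℕ) (u : ℕ → ℝ) (x : ℝ → EuclideanSpace ℝ (Fin n)),
      IsClosedLoop f g h K γ ρ ustar est T d x₀ N u x → (N < ρ → u N = ustar N) →
      (∀ k, k + 1 = N → ρ ≤ N → u N = u k + γ * (virtualInput K
        (fun i => est T (fun t => h (x t) + d t) u k (Fin.castSucc i)) -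
          est T (fun t => h (x t) + d t) u k (Fin.last n))) →
      ∃ y, y (N * T) = x (N * T) ∧ SolvesOn (fun w => f w + u N • g w) y (N * T) T) :
    ∃ (u : ℕ → ℝ) (x : ℝ → EuclideanSpace ℝ (Fin n)),
      IsGlobalClosedLoop f g h K γ ρ ustar est T d x₀ u x := by
  have hnext : ∀ (N : ℕ) (p : {p : (ℕ → ℝ) × (ℝ → EuclideanSpace ℝ (Fin n)) //
      IsClosedLoop f g h K γ ρ ustar est T d x₀ N p.1 p.2}),
      ∃ p' : {p : (ℕ → ℝ) × (ℝ → EuclideanSpace ℝ (Fin n)) //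
        IsClosedLoop f g h K γ ρ ustar est T d x₀ (N + 1) p.1 p.2},
        (∀ j < N, p'.1.1 j = p.1.1 j) ∧ ∀ t ≤ (N : ℝ) * T, p'.1.2 t = p.1.2 t := by
    rintro N ⟨⟨u, x⟩, hux⟩
    -- The loop on `N` intervals leaves the value `u N` free. It is set here by the control law; by
    -- causality this does not change the estimate with index `N - 1` on which it depends.
    set w : ℝ := if N < ρ then ustar N else u (N - 1) + γ * (virtualInput K
      (fun i => est T (fun t => h (x t) + d t) u (N - 1) (Fin.castSucc i)) -
        est T (fun t => h (x t) + d t) u (N - 1) (Fin.last n)) with hw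
    set u' := Function.update u N w with hu'
    have huj : ∀ j < N, u' j = u j := fun j hj => Function.update_of_ne hj.ne _ _
    have huN : u' N = w := Function.update_self _ _ _
    have hux' := hux.congr hT hcausal huj (fun _ _ => rfl)
    have hr1 : N < ρ → u' N = ustar N := fun hN => by rw [huN, hw, if_pos hN]
    have hr2 : ∀ k, k + 1 = N → ρ ≤ N → u' N = u' k + γ * (virtualInput K
        (fun i => est T (fun t => h (x t) + d t) u' k (Fin.castSucc i)) -
          est T (fun t => h (x t) + d t) u' k (Fin.last n)) := by
      intro k hk hN
      have hest : est T (fun t => h (x t) + d t) u' k = est T (fun t => h (x t) + d t) u k :=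
        hcausal T _ _ _ _ k hT (fun t ht => rfl) (fun j hj => huj j (by omega))
      have hk' : N - 1 = k := by omega
      rw [hest, huN, hw, if_neg (by omega), hk', huj k (by omega)]
    obtain ⟨y, hy0, hy⟩ := hstep N u' x hux' hr1 hr2
    exact ⟨⟨⟨u', _⟩, hux'.extend hT hcausal hr1 hr2 hy0 hy⟩, huj, fun t ht => if_pos ht⟩
  have hbase : IsClosedLoop f g h K γ ρ ustar est T d x₀ 0 ustar (fun _ => x₀) :=
    ⟨rfl, ⟨continuousOn_const, fun j hj => absurd hj (by omega)⟩, fun _ _ _ => rfl,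
      fun k hk => absurd hk (by omega)⟩
  choose nxt hnxt1 hnxt2 using hnext
  let p : ∀ N : ℕ, {p : (ℕ → ℝ) × (ℝ → EuclideanSpace ℝ (Fin n)) //
      IsClosedLoop f g h K γ ρ ustar est T d x₀ N p.1 p.2} :=
    fun N => Nat.rec ⟨⟨ustar, fun _ => x₀⟩, hbase⟩ (fun N q => nxt N q) N
  have hp1 : ∀ N M : ℕ, N ≤ M → ∀ j < N, (p M).1.1 j = (p N).1.1 j := by
    intro N M hNM
    induction M, hNM using Nat.le_induction with
    | base => intros; rfl
    | succ M hM ih => exact fun j hj => (hnxt1 M (p M) j (by omega)).trans (ih j hj)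
  have hp2 : ∀ N M : ℕ, N ≤ M → ∀ t ≤ (N : ℝ) * T, (p M).1.2 t = (p N).1.2 t := by
    intro N M hNM
    induction M, hNM using Nat.le_induction with
    | base => intros; rfl
    | succ M hM ih =>
      intro t ht
      have hMN : (N : ℝ) ≤ M := by exact_mod_cast hM
      exact (hnxt2 M (p M) t (ht.trans (by gcongr))).trans (ih t ht)
  -- Each extension keeps earlier data, so `u j` is final from stage `j + 1` and `x t` from stage
  -- `⌈t / T⌉₊`.
  refine ⟨fun j => (p (j + 1)).1.1 j, fun t => (p ⌈t / T⌉₊).1.2 t, fun N => ?_⟩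
  refine (p N).2.congr hT hcausal (fun j hj => (hp1 (j + 1) N hj j (by omega)).symm)
    (fun t ht => (hp2 _ N ?_ t ?_).symm)
  · rw [Nat.ceil_le, div_le_iff₀ hT]; exact ht.2
  · rw [← div_le_iff₀ hT]; exact Nat.le_ceil _

end ClosedLoop

/-! ### Estimation error and bounds on balls -/

section Bounds

variable {n : ℕ} {f g : EuclideanSpace ℝ (Fin n) → EuclideanSpace ℝ (Fin n)}
  {h : EuclideanSpace ℝ (Fin n) → ℝ}

theorem abs_virtualInput_le (K : Fin n → ℝ) (z : Fin n → ℝ) {r : ℝ} (hz : ∀ i, |z i| ≤ r) :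
    |virtualInput K z| ≤ (∑ i, |K i|) * r := by
  rw [virtualInput, Finset.sum_mul]
  refine (Finset.abs_sum_le_sum_abs _ _).trans (Finset.sum_le_sum fun i _ => ?_)
  rw [abs_mul]
  exact mul_le_mul_of_nonneg_left (hz i) (abs_nonneg _)

/-- The controller error caused by an estimate `ẑ` is bounded by the estimation error. -/
theorem abs_controller_error_le (K : Fin n → ℝ) (x : EuclideanSpace ℝ (Fin n)) (u : ℝ)
    (zhat : EuclideanSpace ℝ (Fin (n + 1))) :
    |virtualInput K (fun i => zhat (Fin.castSucc i)) - zhat (Fin.last n) -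
        inputError f g h K x u| ≤ (∑ i, |K i| + 1) * ‖extState f g h x u - zhat‖ := by
  have hcoord : ∀ i, |(extState f g h x u - zhat) i| ≤ ‖extState f g h x u - zhat‖ :=
    fun i => PiLp.norm_apply_le (extState f g h x u - zhat) i
  have h1 : virtualInput K (fun i => zhat (Fin.castSucc i)) - zhat (Fin.last n) -
      inputError f g h K x u =
      (extState f g h x u - zhat) (Fin.last n) -
        virtualInput K (fun i => (extState f g h x u - zhat) (Fin.castSucc i)) := by
    simp only [inputError, virtualInput, extState, PiLp.sub_apply, Fin.snoc_last,
      Fin.snoc_castSucc, mul_sub, Finset.sum_sub_distrib]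
    ring
  rw [h1]
  refine (abs_sub _ _).trans ?_
  have h2 := abs_virtualInput_le K (fun i => (extState f g h x u - zhat) (Fin.castSucc i))
    (fun i => hcoord _)
  linarith [hcoord (Fin.last n)]

/-- The last component equals `K z - e_u`, so bounds on `z` and `e_u` suffice; together with the
estimation error they bound `ẑ`. -/
theorem norm_extState_le (K : Fin n → ℝ) (x : EuclideanSpace ℝ (Fin n)) (u : ℝ) :
    ‖extState f g h x u‖ ≤
      (∑ i, |K i| + 1) * ‖linCoord f h x‖ + |inputError f g h K x u| := by
  have h1 : ‖extState f g h x u‖ ^ 2 =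
      ‖linCoord f h x‖ ^ 2 + |alphaFn f h x + betaFn f g h x * u| ^ 2 := by
    rw [EuclideanSpace.norm_sq_eq, EuclideanSpace.norm_sq_eq, Fin.sum_univ_castSucc]
    simp [extState]
  have h2 : ‖extState f g h x u‖ ≤
      ‖linCoord f h x‖ + |alphaFn f h x + betaFn f g h x * u| := by
    refine (sq_le_sq₀ (norm_nonneg _) (by positivity)).1 ?_
    have : 0 ≤ ‖linCoord f h x‖ * |alphaFn f h x + betaFn f g h x * u| := by positivity
    rw [h1]
    linarith [add_sq ‖linCoord f h x‖ |alphaFn f h x + betaFn f g h x * u|]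
  have h3 : alphaFn f h x + betaFn f g h x * u =
      virtualInput K (fun i => linCoord f h x i) - inputError f g h K x u := by
    rw [inputError]; ring
  have h4 := abs_virtualInput_le K (fun i => linCoord f h x i)
    (fun i => PiLp.norm_apply_le (linCoord f h x) i)
  have h5 := abs_sub (virtualInput K (fun i => linCoord f h x i)) (inputError f g h K x u)
  rw [← h3] at h5
  linarith

theorem exists_lipschitz_bound_on_ball {E F : Type*} [NormedAddCommGroup E] [NormedSpace ℝ E]
    [FiniteDimensional ℝ E] [NormedAddCommGroup F] [NormedSpace ℝ F] {φ : E → F}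
    (hφ : ContDiff ℝ ∞ φ) (R : ℝ) :
    ∃ l, 0 ≤ l ∧ ∀ z w, ‖z‖ ≤ R → ‖w‖ ≤ R → ‖φ z - φ w‖ ≤ l * ‖z - w‖ := by
  have : ProperSpace E := FiniteDimensional.proper ℝ E
  obtain ⟨l, hl⟩ := hφ.contDiffOn.exists_lipschitzOnWith (s := Metric.closedBall 0 R)
    (by simp) (convex_closedBall _ _) (isCompact_closedBall _ _)
  refine ⟨l, l.2, fun z w hz hw => ?_⟩
  rw [← dist_eq_norm, ← dist_eq_norm]
  exact hl.dist_le_mul z (by simpa using hz) w (by simpa using hw)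

theorem exists_pos_lower_bound_on_ball {E : Type*} [NormedAddCommGroup E] [ProperSpace E]
    {φ : E → ℝ} (hφ : Continuous φ) (hpos : ∀ z, 0 < φ z) (R : ℝ) :
    ∃ m > 0, ∀ z, ‖z‖ ≤ R → m ≤ φ z := by
  by_cases hR : 0 ≤ R
  · obtain ⟨z₀, -, hz₀⟩ := (isCompact_closedBall (0 : E) R).exists_isMinOn
      ⟨0, by simpa using hR⟩ hφ.continuousOn
    exact ⟨φ z₀, hpos _, fun z hz => hz₀ (by simpa using hz)⟩
  · exact ⟨1, one_pos, fun z hz => absurd ((norm_nonneg z).trans hz) hR⟩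

theorem SolvesOn.linCoord (hf : ContDiff ℝ ∞ f) (hh : ContDiff ℝ ∞ h)
    (hrel : HasPosRelativeDegree f g h) (hΨ : Continuous (linCoord f h)) (K : Fin n → ℝ)
    {G β : EuclideanSpace ℝ (Fin n) → ℝ}
    (hinp : ∀ x u, inputError f g h K x u = G (linCoord f h x) - β (linCoord f h x) * u)
    {x : ℝ → EuclideanSpace ℝ (Fin n)} {s T u : ℝ}
    (hx : SolvesOn (fun w => f w + u • g w) x s T) :
    SolvesOn (fun w => Matrix.toEuclideanCLM (𝕜 := ℝ)
      (chainA n + Matrix.vecMulVec (chainB n) K) w - (G w - β w * u) • WithLp.toLp 2 (chainB n))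
      (fun t => _root_.linCoord f h (x t)) s T := by
  refine ⟨hΨ.comp_continuousOn hx.1, fun t ht => ?_⟩
  simp only [← hinp]
  exact hasDerivWithinAt_linCoord hf hh hrel K (hx.2 t ht)

end Bounds

/-! ### Ultimate bound and main theorem -/

/-- An upper bound that decays geometrically with the sampling instants up to an offset. -/
theorem limsup_le_of_geometric_sampling {φ : ℝ → ℝ} {T q c δ : ℝ} {ρ : ℕ} (hT : 0 < T)
    (hφ0 : ∀ t, 0 ≤ φ t) (hq0 : 0 ≤ q) (hq1 : q < 1)
    (hφ : ∀ k : ℕ, ρ ≤ k + 1 → ∀ t ∈ Set.Icc (k * T) (k * T + T),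
      φ t ≤ c * (q ^ (k + 1 - ρ) + δ)) :
    Filter.limsup φ Filter.atTop ≤ c * δ := by
  have hfloor : Filter.Tendsto (fun t : ℝ => ⌊t / T⌋₊) Filter.atTop Filter.atTop :=
    tendsto_nat_floor_atTop.comp (Filter.tendsto_id.atTop_div_const hT)
  have hpow : Filter.Tendsto (fun k : ℕ => c * (q ^ (k + 1 - ρ) + δ)) Filter.atTop
      (nhds (c * (0 + δ))) := by
    refine ((Filter.Tendsto.add_const δ ?_)).const_mul c
    exact (tendsto_pow_atTop_nhds_zero_of_lt_one hq0 hq1).comp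
      ((Filter.tendsto_sub_atTop_nat ρ).comp (Filter.tendsto_add_atTop_nat 1))
  rw [zero_add] at hpow
  refine le_of_forall_pos_le_add fun η hη => ?_
  refine Filter.limsup_le_of_le (Filter.isCoboundedUnder_le_of_le _ hφ0) ?_
  have h1 := (hpow.comp hfloor).eventually (gt_mem_nhds (show c * δ < c * δ + η by linarith))
  filter_upwards [h1, hfloor.eventually_ge_atTop ρ, Filter.eventually_ge_atTop 0]
    with t ht htρ ht0
  refine (hφ ⌊t / T⌋₊ (by omega) t ⟨?_, ?_⟩).trans ht.le
  · rw [← le_div_iff₀ hT]; exact Nat.floor_le (by positivity)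
  · have := (div_lt_iff₀ hT).1 (Nat.lt_floor_add_one (t / T))
    linarith

theorem theorem2 (n : ℕ) (hn : 1 ≤ n)
    (f g : EuclideanSpace ℝ (Fin n) → EuclideanSpace ℝ (Fin n))
    (h : EuclideanSpace ℝ (Fin n) → ℝ)
    (hf : ContDiff ℝ ∞ f) (hg : ContDiff ℝ ∞ g) (hh : ContDiff ℝ ∞ h)
    (hrel : HasPosRelativeDegree f g h)
    (hdiff : IsGlobalDiffeo (linCoord f h)) (hzero : linCoord f h 0 = 0)
    (K : Fin n → ℝ) (hK : IsStabilizingGain K)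
    (ρ : ℕ) (hρ : n + 1 ≤ ρ) (ustar : ℕ → ℝ)
    (S : Set (EuclideanSpace ℝ (Fin n))) (hS : IsCompact S) (hS0 : 0 ∈ interior S) :
    ∃ γmax > (0 : ℝ),
      (∀ βbar : ℝ, (∀ x, betaFn f g h x ≤ βbar) → βbar⁻¹ ≤ γmax) ∧
      ∀ γ ∈ Set.Ioo 0 γmax,
        ∀ D : Set (ℝ → ℝ), (∀ d ∈ D, EssBounded d) →
        ∀ est : Estimator n, est.IsCausal → est.HasErrorBound f g h K γ ρ ustar D →
        ∃ Tstar > (0 : ℝ), ∃ b₁ > (0 : ℝ), ∃ b₂ > (0 : ℝ), ∃ b₃ > (0 : ℝ),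
          ∀ T ∈ Set.Ioc 0 Tstar, ∀ d ∈ D, noiseLevel d ≤ b₁ * T ^ n → ∀ x₀ ∈ S,
            (∃ (u : ℕ → ℝ) (x : ℝ → EuclideanSpace ℝ (Fin n)),
              IsGlobalClosedLoop f g h K γ ρ ustar est T d x₀ u x) ∧
            ∀ (u : ℕ → ℝ) (x : ℝ → EuclideanSpace ℝ (Fin n)),
              IsGlobalClosedLoop f g h K γ ρ ustar est T d x₀ u x →
              (∀ k : ℕ, ρ ≤ k + 1 → ‖est T (fun t => h (x t) + d t) u k‖ ≤ b₂) ∧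
              (∀ k : ℕ, |inputError f g h K (x (k * T)) (u k)| ≤ b₂) ∧
              (∀ t : ℝ, 0 ≤ t → ‖x t‖ ≤ b₂) ∧
              Filter.limsup (fun t => ‖x t‖) Filter.atTop ≤ b₃ * noiseLevel d / T ^ n := by
  obtain ⟨hΨ, Φ, hΦ, hΦΨ, -⟩ := hdiff
  obtain ⟨P, Q, hP, hQ, hPQ⟩ := hK
  obtain ⟨Λ, p, hp, a, ha, τ, hτ, hΛ, hLyap⟩ := exists_euler_contraction hP hQ hPQ
  set A := Matrix.toEuclideanCLM (𝕜 := ℝ) (chainA n + Matrix.vecMulVec (chainB n) K) with hA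
  set G : EuclideanSpace ℝ (Fin n) → ℝ :=
    fun z => virtualInput K (fun i => z i) - alphaFn f h (Φ z) with hG
  set β : EuclideanSpace ℝ (Fin n) → ℝ := fun z => betaFn f g h (Φ z) with hβ
  have hv : ContDiff ℝ ∞ (fun z : EuclideanSpace ℝ (Fin n) => virtualInput K (fun i => z i)) := by
    unfold virtualInput
    fun_prop
  have hGs : ContDiff ℝ ∞ G := hv.sub ((hf.alphaFn hh).comp hΦ)
  have hβs : ContDiff ℝ ∞ β := (hf.betaFn hg hh).comp hΦ
  have hβpos : ∀ z, 0 < β z := fun z => hrel.2 _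
  have hinp : ∀ x u, inputError f g h K x u = G (linCoord f h x) - β (linCoord f h x) * u := by
    intro x u
    simp only [hG, hβ, hΦΨ x, inputError]
    ring
  have hΦ0 : Φ 0 = 0 := by simpa [hzero] using hΦΨ 0
  set u₀ := eqInput f g h with hu₀
  have heq : G 0 - β 0 * u₀ = 0 := by
    have h1 : betaFn f g h 0 ≠ 0 := (hrel.2 0).ne'
    simp only [hG, hβ, hu₀, hΦ0, eqInput, virtualInput, PiLp.zero_apply, mul_zero,
      Finset.sum_const_zero]
    field_simp
    ring
  obtain ⟨R₀, hR₀⟩ := hS.exists_bound_of_continuousOn hΨ.continuous.continuousOn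
  have hR₀0 : 0 ≤ R₀ := (norm_nonneg _).trans (hR₀ 0 (interior_subset hS0))
  obtain ⟨R, hR, hmain⟩ := exists_closedLoop_invariance A (WithLp.toLp 2 (chainB n)) Λ G β hp hΛ
    ha hτ hLyap (exists_lipschitz_bound_on_ball hGs) (exists_lipschitz_bound_on_ball hβs)
    (exists_pos_lower_bound_on_ball hβs.continuous hβpos) heq ρ (by omega) ustar hR₀0
  -- `γmax` is the inverse of the maximum of `β` on the ball. As this maximum is a value of `β`, no
  -- global upper bound can be smaller.
  obtain ⟨z₁, -, hz₁⟩ := (isCompact_closedBall (0 : EuclideanSpace ℝ (Fin n)) R).exists_isMaxOn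
    ⟨0, by simpa using hR.le⟩ hβs.continuous.continuousOn
  refine ⟨(β z₁)⁻¹, inv_pos.2 (hβpos _), fun βbar hβbar =>
    inv_anti₀ (hβpos z₁) (hβbar (Φ z₁)), ?_⟩
  intro γ hγ D hD est hcausal hest
  have hγβ : ∀ z, ‖z‖ ≤ R → γ * β z ≤ 1 := by
    intro z hz
    have h1 : β z ≤ β z₁ := hz₁ (by simpa using hz)
    have h2 : γ * β z₁ ≤ 1 := by
      rw [← le_div_iff₀ (hβpos z₁), one_div]; exact hγ.2.le
    exact (mul_le_mul_of_nonneg_left h1 hγ.1.le).trans h2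
  obtain ⟨U, B, hUB⟩ := hmain γ hγ.1 hγβ
  -- `R` and `U` are already fixed, so the constant `M` of this compact set can be fed back into
  -- `hUB`.
  obtain ⟨M, hM, T₀, hT₀, hbound⟩ := hest (Metric.closedBall 0 R ×ˢ Set.Icc (-U) U)
    ((isCompact_closedBall _ _).prod isCompact_Icc)
  set κ := ∑ i, |K i| + 1 with hκ
  have hκ0 : 0 < κ := by positivity
  obtain ⟨C, hC, ν, hν, b₁, hb₁, τ₁, hτ₁, hντ, hinv⟩ := hUB (κ * M) (by positivity)
  obtain ⟨lΦ, hlΦ0, hlΦ⟩ := exists_lipschitz_bound_on_ball hΦ R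
  have hxz : ∀ x, ‖linCoord f h x‖ ≤ R → ‖x‖ ≤ lΦ * ‖linCoord f h x‖ := by
    intro x hx
    have := hlΦ (linCoord f h x) 0 hx (by simpa using hR.le)
    rwa [hΦΨ x, hΦ0, sub_zero, sub_zero] at this
  obtain ⟨τ₂, hτ₂, hlocal⟩ := exists_uniform_local_solution hf hg (lΦ * R) U
  set bz := κ * R + |B| + M * (R + (|U| + |u₀|)) + M * b₁ with hbz
  have hbz0 : 0 ≤ bz := by positivity
  refine ⟨min (min τ₁ T₀) (min τ₂ 1), by positivity, b₁, hb₁, bz + |B| + lΦ * R + 1,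
    by positivity, lΦ * C + 1, by positivity, ?_⟩
  intro T hT d hd hdb x₀ hx₀
  have hT0 : 0 < T := hT.1
  have hTτ₁ : T ∈ Set.Ioc 0 τ₁ :=
    ⟨hT0, hT.2.trans ((min_le_left _ _).trans (min_le_left _ _))⟩
  have hTT₀ : T ∈ Set.Ioc 0 T₀ :=
    ⟨hT0, hT.2.trans ((min_le_left _ _).trans (min_le_right _ _))⟩
  have hTτ₂ : T ∈ Set.Ioc 0 τ₂ :=
    ⟨hT0, hT.2.trans ((min_le_right _ _).trans (min_le_left _ _))⟩
  have hT1 : T ≤ 1 := hT.2.trans ((min_le_right _ _).trans (min_le_right _ _))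
  set δ := noiseLevel d / T ^ n with hδ
  have hnoise : 0 ≤ noiseLevel d := ENNReal.toReal_nonneg
  have hδ0 : 0 ≤ δ := by positivity
  have hδb : δ ≤ b₁ := by rw [hδ, div_le_iff₀ (by positivity)]; exact hdb
  have hcompact : ∀ x u, ‖linCoord f h x‖ ≤ R → |u| ≤ U →
      (linCoord f h x, u) ∈ Metric.closedBall (0 : EuclideanSpace ℝ (Fin n)) R ×ˢ Set.Icc (-U) U :=
    fun x u hx hu => ⟨by simpa using hx, abs_le.1 hu⟩
  -- Stated for a finite horizon together with the next input `u N`, so that it serves both to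
  -- continue a partial solution and to bound a global one.
  have hloop : ∀ (N : ℕ) (u : ℕ → ℝ) (x : ℝ → EuclideanSpace ℝ (Fin n)),
      IsClosedLoop f g h K γ ρ ustar est T d x₀ N u x → (N < ρ → u N = ustar N) →
      (∀ k, k + 1 = N → ρ ≤ N → u N = u k + γ * (virtualInput K
        (fun i => est T (fun t => h (x t) + d t) u k (Fin.castSucc i)) -
          est T (fun t => h (x t) + d t) u k (Fin.last n))) →
      (∀ k ≤ N, ‖linCoord f h (x (k * T))‖ ≤ R ∧ |u k| ≤ U ∧
          |inputError f g h K (x (k * T)) (u k)| ≤ B) ∧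
        (∀ k < N, ∀ t ∈ Set.Icc (k * T) (k * T + T), ‖linCoord f h (x t)‖ ≤ R) ∧
        ∀ k < N, ρ ≤ k + 1 → ∀ t ∈ Set.Icc (k * T) (k * T + T),
          ‖linCoord f h (x t)‖ ≤ C * ((1 - ν * T) ^ (k + 1 - ρ) + δ) := by
    intro N u x hx hr1 hr2
    have hx' := hx
    obtain ⟨h0, hsol, hust, hupd⟩ := hx'
    simp only [hinp]
    refine hinv T hTτ₁ δ ⟨hδ0, hδb⟩ N u (fun k => virtualInput K
        (fun i => est T (fun t => h (x t) + d t) u k (Fin.castSucc i)) -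
          est T (fun t => h (x t) + d t) u k (Fin.last n) -
          inputError f g h K (x (k * T)) (u k)) (fun t => linCoord f h (x t)) ?_ ?_ ?_ ?_ ?_
    · rw [h0]; exact hR₀ x₀ hx₀
    · exact fun k hk => (hsol.solvesOn hT0 hk).linCoord hf hh hrel hΨ.continuous K hinp
    · intro k hk hkρ
      rcases hk.lt_or_eq with hk | rfl
      · exact hust k hk hkρ
      · exact hr1 hkρ
    · intro k hk hkρ
      rw [← hinp, add_sub_cancel]
      rcases Nat.lt_or_ge (k + 1) N with hk' | hk'
      · exact hupd k hk' hkρ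
      · have hkN : k + 1 = N := by omega
        rw [hkN]
        exact hr2 k hkN (by omega)
    · intro k hk hkρ hpast
      refine (abs_controller_error_le K _ _ _).trans ?_
      have h1 := hbound T hTT₀ d hd x₀ k u x hkρ (hx.mono hT0.le hk) (fun j hj t ht => by
        obtain ⟨h2, h3⟩ := hpast j hj
        exact hcompact _ _ (h3 t ⟨ht.1, by linarith [ht.2]⟩) h2)
      have h4 : √(‖linCoord f h (x (k * T))‖ ^ 2 + (u k - u₀) ^ 2) ≤
          ‖linCoord f h (x (k * T))‖ + |u k - u₀| := by
        have h5 : 0 ≤ ‖linCoord f h (x (k * T))‖ * |u k - u₀| := by positivity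
        refine Real.sqrt_le_iff.2 ⟨by positivity, ?_⟩
        rw [← sq_abs (u k - u₀), add_sq]
        linarith
      calc κ * ‖extState f g h (x (k * T)) (u k) - est T (fun t => h (x t) + d t) u k‖
          ≤ κ * (M * T * (‖linCoord f h (x (k * T))‖ + |u k - u₀|) + M * δ) := by
            refine mul_le_mul_of_nonneg_left (h1.trans ?_) hκ0.le
            rw [hδ, mul_div_assoc]
            gcongr
        _ = _ := by ring
  refine ⟨exists_isGlobalClosedLoop hT0 hcausal fun N u x hx hr1 hr2 => ?_, fun u x hx => ?_⟩
  · obtain ⟨h1, h2, -⟩ := (hloop N u x hx hr1 hr2).1 N le_rfl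
    exact hlocal T hTτ₂ _ _ _ ((hxz _ h1).trans (by gcongr)) h2
  -- The law for `u N` is read off from the closed loop on `N + 1` intervals.
  have hall : ∀ N : ℕ, _ := fun N => hloop N u x (hx N)
    (fun hN => (hx (N + 1)).2.2.1 N (by omega) hN)
    (fun k hk hN => by subst hk; exact (hx (k + 1 + 1)).2.2.2 k (by omega) hN)
  have hball : ∀ k : ℕ, ∀ t ∈ Set.Icc (k * T) (k * T + T), ‖linCoord f h (x t)‖ ≤ R :=
    fun k => (hall (k + 1)).2.1 k (by omega)
  have hsamp := fun k => (hall k).1 k le_rfl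
  have hlR : 0 ≤ lΦ * R := by positivity
  have hB0 := abs_nonneg B
  refine ⟨fun k hk => ?_, fun k => ?_, fun t ht => ?_, ?_⟩
  · obtain ⟨h1, h2, h3⟩ := hsamp k
    have h4 := hbound T hTT₀ d hd x₀ k u x hk (hx (k + 1)) (fun j hj t ht =>
      hcompact _ _ (hball j t ⟨ht.1, by linarith [ht.2]⟩) (hsamp j).2.1)
    have h5 : √(‖linCoord f h (x (k * T))‖ ^ 2 + (u k - u₀) ^ 2) ≤ R + (|U| + |u₀|) := by
      have h6 : |u k - u₀| ≤ |U| + |u₀| :=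
        (abs_sub _ _).trans (add_le_add (h2.trans (le_abs_self U)) le_rfl)
      refine Real.sqrt_le_iff.2 ⟨by positivity, ?_⟩
      have h7 : ‖linCoord f h (x (k * T))‖ ^ 2 ≤ R ^ 2 := by gcongr
      have h8 : |u k - u₀| ^ 2 ≤ (|U| + |u₀|) ^ 2 := by gcongr
      have h9 : 0 ≤ R * (|U| + |u₀|) := by positivity
      rw [← sq_abs (u k - u₀), add_sq]
      linarith
    have h10 := norm_extState_le (f := f) (g := g) (h := h) K (x (k * T)) (u k)
    have h11 : κ * ‖linCoord f h (x (k * T))‖ ≤ κ * R := by gcongr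
    have h12 : M * T * √(‖linCoord f h (x (k * T))‖ ^ 2 + (u k - u₀) ^ 2) ≤
        M * 1 * (R + (|U| + |u₀|)) := by gcongr
    have h13 : M * noiseLevel d / T ^ n ≤ M * b₁ := by
      rw [mul_div_assoc]; gcongr
    have h14 := norm_sub_norm_le (est T (fun t => h (x t) + d t) u k)
      (extState f g h (x (k * T)) (u k))
    rw [norm_sub_rev] at h14
    linarith [le_abs_self B]
  · linarith [(hsamp k).2.2, le_abs_self B]
  · have h1 : t ∈ Set.Icc ((⌊t / T⌋₊ : ℝ) * T) (⌊t / T⌋₊ * T + T) := by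
      constructor
      · rw [← le_div_iff₀ hT0]; exact Nat.floor_le (by positivity)
      · have := (div_lt_iff₀ hT0).1 (Nat.lt_floor_add_one (t / T))
        linarith
    have h2 := hball _ t h1
    have h3 : lΦ * ‖linCoord f h (x t)‖ ≤ lΦ * R := by gcongr
    linarith [hxz _ h2]
  · have hνT : ν * T ≤ 1 := (mul_le_mul_of_nonneg_left hTτ₁.2 hν.le).trans hντ
    have h1 : Filter.limsup (fun t => ‖x t‖) Filter.atTop ≤ lΦ * C * δ := by
      refine limsup_le_of_geometric_sampling (q := 1 - ν * T) (ρ := ρ) hT0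
        (fun t => norm_nonneg _) (by linarith) (by have : 0 < ν * T := by positivity
                                                   linarith) ?_
      intro k hk t ht
      have h2 := (hall (k + 1)).2.2 k (by omega) hk t ht
      calc ‖x t‖ ≤ lΦ * ‖linCoord f h (x t)‖ := hxz _ (hball k t ht)
        _ ≤ lΦ * (C * ((1 - ν * T) ^ (k + 1 - ρ) + δ)) := by gcongr
        _ = _ := by ring
    rw [mul_div_assoc]
    linarith [h1]
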